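/- Let $M$ and $W$ be sets of $n$ men and $n$ women, let $\succ$ be a preference profile in which every agent has a strict total order over all agents of the other side, and fix a man $m \in M$ (the accomplice). Write $\mathrm{DA}(\cdot)$ for the matching computed by the men-proposing deferred acceptance algorithm and let $\mu = \mathrm{DA}(\succ)$. A strategy of $m$ is a list $\succ'_m$ over $W$; put $\mu' = \mathrm{DA}(\succ_{-m}, \succ'_m)$. It is no-regret if $\mu'(m) \succeq_m \mu(m)$. It is an optimal one-for-all strategy if it is no-regret, every woman weakly prefers $\mu'$ to $\mu$, and every woman weakly prefers $\mu'$ to $\mathrm{DA}(\succ_{-m}, \succ''_m)$ for every no-regret strategy $\succ''_m$ (all with respect to the true lists). It pushes up the women who are below $\mu(m)$ in $\succ_m$ and above $\mu(m)$ in $\succ'_m$. An optimal one-for-all strategy is minimum if no optimal one-for-all strategy pushes up fewer women. For $X \subseteq W$ let $\succ_m^{X\uparrow}$ be the list obtained from $\succ_m$ by moving the women of $X$ who are below $\mu(m)$ to places just above $\mu(m)$, in their original order, let $\mu^X = \mathrm{DA}(\succ_{-m}, \succ_m^{X\uparrow})$, and let $W^{\mathrm{NR}}$ be the set of all $w \in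 W$ for which $\succ_m^{\{w\}\uparrow}$ is no-regret. A set $Y \subseteq W^{\mathrm{NR}}$ is a minimum no-regret push up set if $\mu^Y = \mu^{W^{\mathrm{NR}}}$ and $|Y| \le |Z|$ for all $Z \subseteq W^{\mathrm{NR}}$ with $\mu^Z = \mu^{W^{\mathrm{NR}}}$. Consider the following greedy algorithm. Start with $Y = W^{\mathrm{NR}}$. Go through the women $w \in Y$; whenever $\mu^{Y \setminus \{w\}} = \mu^{W^{\mathrm{NR}}}$, replace $Y$ by $Y \setminus \{w\}$ and restart. When no $w \in Y$ can be removed, return $Y$. (1) In whatever order the women are tried, every set $Y$ returned by this algorithm is a minimum no-regret push up set, and $\succ_m^{Y\uparrow}$ is a minimum optimal one-for-all strategy of $m$. (2) The algorithm computes a minimum optimal one-for-all strategy in $O(n^4)$ time: an explicit implementation of it on a unit-cost random access machine (whose only arithmetic operations are successor and comparison), given the preference lists and $m$, terminates after at most $C n^4$ steps, with a constant $C$ that does not depend on $n$, $\succ$ or $m$, and outputs a set $Y$ that the algorithm may return, together with the list $\succ_m^{Y\uparrow}$. -/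

import Mathlib

namespace StableMarriage

/-! ## Preference lists, profiles -/

/-- A preference list: a strict total order on `Fin n`, written from best to worst. -/
structure PrefList (n : ℕ) where
  toList : List (Fin n)
  nodup : toList.Nodup
  mem : ∀ a, a ∈ toList

/-- `a` is ranked strictly above `b`. -/
def PrefList.Prefers {n : ℕ} (l : PrefList n) (a b : Fin n) : Prop :=
  l.toList.idxOf a < l.toList.idxOf b

instance {n : ℕ} (l : PrefList n) (a b : Fin n) : Decidable (l.Prefers a b) :=
  inferInstanceAs (Decidable (_ < _))

/-- `a` is ranked strictly above `b`, or equals `b`. -/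
def PrefList.WeaklyPrefers {n : ℕ} (l : PrefList n) (a b : Fin n) : Prop :=
  l.Prefers a b ∨ a = b

/-- A preference profile of `n` men and `n` women, both indexed by `Fin n`. -/
structure Profile (n : ℕ) where
  men : Fin n → PrefList n
  women : Fin n → PrefList n

/-! ## The deferred acceptance algorithm

The state records how many women have rejected each man. As a man goes down his list, his current
proposal is to the first woman who has not rejected him, i.e. to the entry at that position. -/

/-- The woman to whom `m` currently proposes (or is tentatively engaged); `none` if everyone
has rejected him. -/
def proposal {n : ℕ} (P : Profile n) (k : Fin n → ℕ) (m : Fin n) : Option (Fin n) :=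
  (P.men m).toList[k m]?

/-- The woman to whom `m` currently proposes has another current proposal that she prefers. -/
def Rejected {n : ℕ} (P : Profile n) (k : Fin n → ℕ) (m : Fin n) : Prop :=
  ∃ w, proposal P k m = some w ∧ ∃ m', proposal P k m' = some w ∧ (P.women w).Prefers m' m

instance {n : ℕ} (P : Profile n) (k : Fin n → ℕ) (m : Fin n) : Decidable (Rejected P k m) :=
  inferInstanceAs (Decidable (∃ _, _))

/-- One round: every woman keeps her favourite current proposal and rejects all the others. -/
def daRound {n : ℕ} (P : Profile n) (k : Fin n → ℕ) : Fin n → ℕ :=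
  fun m => if Rejected P k m then k m + 1 else k m

/-- The final state. There are at most `n * n` rejections, so that `n * n` rounds suffice
(see `daRound_daState`: nobody is rejected any more). -/
def daState {n : ℕ} (P : Profile n) : Fin n → ℕ :=
  (daRound P)^[n * n] (fun _ => 0)

theorem PrefList.length_eq {n : ℕ} (l : PrefList n) : l.toList.length = n := by
  have h := List.toFinset_card_of_nodup l.nodup
  have h2 : l.toList.toFinset = Finset.univ := by
    ext a; simp [l.mem a]
  rw [h2] at h
  simpa using h.symm

theorem PrefList.idxOf_inj {n : ℕ} (l : PrefList n) {a b : Fin n}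
    (h : l.toList.idxOf a = l.toList.idxOf b) : a = b :=
  (List.idxOf_inj (l.mem a)).1 h

theorem proposal_eq_some_iff {n : ℕ} (P : Profile n) (k : Fin n → ℕ) (m w : Fin n) :
    proposal P k m = some w ↔ (P.men m).toList.idxOf w = k m := by
  unfold proposal
  constructor
  · intro h
    obtain ⟨hk, h⟩ := List.getElem?_eq_some_iff.1 h
    rw [← h]
    exact (P.men m).nodup.idxOf_getElem _ hk
  · intro h
    rw [← h]
    have h1 : (P.men m).toList.idxOf w < (P.men m).toList.length :=
      List.idxOf_lt_length_iff.2 ((P.men m).mem w)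
    rw [List.getElem?_eq_getElem h1, List.getElem_idxOf]

/-- Invariant of deferred acceptance: whoever has rejected a man holds a proposal that she
prefers; and the counters never exceed `n`. -/
def DAInvariant {n : ℕ} (P : Profile n) (k : Fin n → ℕ) : Prop :=
  (∀ m, k m ≤ n) ∧ ∀ m w, (P.men m).toList.idxOf w < k m →
    ∃ m', proposal P k m' = some w ∧ (P.women w).Prefers m' m

theorem daInvariant_daRound {n : ℕ} (P : Profile n) (k : Fin n → ℕ) (hk : DAInvariant P k) :
    DAInvariant P (daRound P k) := by
  obtain ⟨h1, h2⟩ := hk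
  -- a woman with a current proposal keeps her favourite one
  have key : ∀ w m, proposal P k m = some w →
      ∃ m', proposal P (daRound P k) m' = some w ∧ (P.women w).WeaklyPrefers m' m := by
    intro w m hm
    classical
    obtain ⟨b, hb, hmin⟩ := Finset.exists_min_image
      (Finset.univ.filter (fun b => proposal P k b = some w))
      (fun b => (P.women w).toList.idxOf b) ⟨m, by simp [hm]⟩
    simp only [Finset.mem_filter, Finset.mem_univ, true_and] at hb hmin
    refine ⟨b, ?_, ?_⟩
    · have hnr : ¬ Rejected P k b := by
        rintro ⟨w', hw', m', hm', hp⟩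
        rw [hb] at hw'
        cases hw'
        exact absurd (hmin m' hm') (not_le.2 hp)
      unfold proposal daRound
      rw [if_neg hnr]
      exact hb
    · rcases (hmin m hm).lt_or_eq with h | h
      · exact Or.inl h
      · exact Or.inr ((P.women w).idxOf_inj h)
  refine ⟨?_, ?_⟩
  · intro m
    unfold daRound
    split_ifs with h
    · obtain ⟨w, hw, -⟩ := h
      rw [proposal_eq_some_iff] at hw
      have : (P.men m).toList.idxOf w < (P.men m).toList.length :=
        List.idxOf_lt_length_iff.2 ((P.men m).mem w)
      rw [PrefList.length_eq] at this
      omega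
    · exact h1 m
  · intro m w hlt
    have : ∃ m', proposal P k m' = some w ∧ (P.women w).Prefers m' m := by
      by_cases hm : (P.men m).toList.idxOf w < k m
      · exact h2 m w hm
      · unfold daRound at hlt
        split_ifs at hlt with h
        · obtain ⟨w', hw', h'⟩ := h
          have h3 := (proposal_eq_some_iff P k m w').1 hw'
          have : w' = w := (P.men m).idxOf_inj (by omega)
          subst this
          exact h'
        · exact absurd hlt hm
    obtain ⟨m', hm', hp⟩ := this
    obtain ⟨b, hb, hbm⟩ := key w m' hm'
    refine ⟨b, hb, ?_⟩
    rcases hbm with h | h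
    · exact lt_trans h hp
    · rw [h]; exact hp

theorem daInvariant_iterate {n : ℕ} (P : Profile n) (t : ℕ) :
    DAInvariant P ((daRound P)^[t] (fun _ => 0)) := by
  induction t with
  | zero => exact ⟨fun _ => Nat.zero_le _, fun m w h => absurd h (Nat.not_lt_zero _)⟩
  | succ t ih =>
    rw [Function.iterate_succ_apply']
    exact daInvariant_daRound P _ ih

theorem le_daRound {n : ℕ} (P : Profile n) (k : Fin n → ℕ) (m : Fin n) :
    k m ≤ daRound P k m := by
  unfold daRound; split_ifs <;> omega

theorem iterate_sum {n : ℕ} (P : Profile n) (t : ℕ) :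
    daRound P ((daRound P)^[t] (fun _ => 0)) = (daRound P)^[t] (fun _ => 0) ∨
      t + 1 ≤ ∑ m, daRound P ((daRound P)^[t] (fun _ => 0)) m := by
  have strict : ∀ k : Fin n → ℕ, daRound P k = k ∨ ∑ m, k m + 1 ≤ ∑ m, daRound P k m := by
    intro k
    by_cases h : daRound P k = k
    · exact Or.inl h
    · right
      obtain ⟨m, hm⟩ := Function.ne_iff.1 h
      exact Finset.sum_lt_sum (fun i _ => le_daRound P k i)
        ⟨m, Finset.mem_univ _, lt_of_le_of_ne (le_daRound P k m) (Ne.symm hm)⟩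
  induction t with
  | zero =>
    rcases strict (fun _ => 0) with h | h
    · exact Or.inl h
    · right; simp only [Function.iterate_zero, id]; omega
  | succ t ih =>
    rw [Function.iterate_succ_apply']
    rcases ih with h | h
    · left; rw [h, h]
    · rcases strict (daRound P ((daRound P)^[t] (fun _ => 0))) with h' | h'
      · exact Or.inl h'
      · right; omega

/-- Deferred acceptance has terminated in the state `daState P`. -/
theorem daRound_daState {n : ℕ} (P : Profile n) : daRound P (daState P) = daState P := by
  rcases iterate_sum P (n * n) with h | h
  · exact h
  · exfalso
    have h1 : ∑ m, daRound P ((daRound P)^[n * n] (fun _ => 0)) m ≤ ∑ _m : Fin n, n := by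
      apply Finset.sum_le_sum
      intro i _
      have := (daInvariant_iterate P (n * n + 1)).1 i
      rwa [Function.iterate_succ_apply'] at this
    simp only [Finset.sum_const, Finset.card_univ, Fintype.card_fin, smul_eq_mul] at h1
    omega

theorem not_rejected_daState {n : ℕ} (P : Profile n) (m : Fin n) :
    ¬ Rejected P (daState P) m := by
  intro h
  have := congrFun (daRound_daState P) m
  unfold daRound at this
  rw [if_pos h] at this
  omega

theorem proposal_daState_injective {n : ℕ} (P : Profile n) {m m' w : Fin n}
    (h : proposal P (daState P) m = some w) (h' : proposal P (daState P) m' = some w) :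
    m = m' := by
  rcases lt_trichotomy ((P.women w).toList.idxOf m) ((P.women w).toList.idxOf m') with hl | hl | hl
  · exact absurd ⟨w, h', m, h, hl⟩ (not_rejected_daState P m')
  · exact (P.women w).idxOf_inj hl
  · exact absurd ⟨w, h, m', h', hl⟩ (not_rejected_daState P m)

/-- In the final state every man holds an engagement. -/
theorem proposal_daState_isSome {n : ℕ} (P : Profile n) (m : Fin n) :
    (proposal P (daState P) m).isSome := by
  by_contra hcon
  have hinv := daInvariant_iterate P (n * n)
  change DAInvariant P (daState P) at hinv
  have hnone : proposal P (daState P) m = none := by simpa using hcon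
  have hlen : n ≤ daState P m := by
    unfold proposal at hnone
    rw [List.getElem?_eq_none_iff, PrefList.length_eq] at hnone
    exact hnone
  have hall : ∀ w, ∃ m', proposal P (daState P) m' = some w := by
    intro w
    have : (P.men m).toList.idxOf w < (P.men m).toList.length :=
      List.idxOf_lt_length_iff.2 ((P.men m).mem w)
    rw [PrefList.length_eq] at this
    obtain ⟨m', hm', -⟩ := hinv.2 m w (by omega)
    exact ⟨m', hm'⟩
  choose f hf using hall
  have hinj : Function.Injective f := by
    intro a b hab
    have h1 := hf a
    rw [hab, hf b] at h1
    exact (Option.some.inj h1).symm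
  obtain ⟨w, hw⟩ := Finite.surjective_of_injective hinj m
  have h2 := hf w
  rw [hw, hnone] at h2
  cases h2

/-- The woman with whom deferred acceptance matches the man `m`. -/
def daPartner {n : ℕ} (P : Profile n) (m : Fin n) : Fin n :=
  (proposal P (daState P) m).get (proposal_daState_isSome P m)

theorem daPartner_bijective {n : ℕ} (P : Profile n) : Function.Bijective (daPartner P) := by
  apply Function.Injective.bijective_of_finite
  intro a b hab
  refine proposal_daState_injective P (w := daPartner P a) ?_ ?_
  · simp [daPartner]
  · rw [hab]; simp [daPartner]

/-- The matching computed by deferred acceptance: `da P m` is the partner of the man `m` and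
`(da P).symm w` is the partner of the woman `w`. -/
noncomputable def da {n : ℕ} (P : Profile n) : Fin n ≃ Fin n :=
  Equiv.ofBijective (daPartner P) (daPartner_bijective P)

/-! ## One-for-all strategies of an accomplice -/

/-- The profile in which the man `m` reports the list `l` and everybody else is unchanged. -/
def misreport {n : ℕ} (P : Profile n) (m : Fin n) (l : PrefList n) : Profile n where
  men := Function.update P.men m l
  women := P.women

/-- Every woman weakly prefers `μ` to `μ'` with respect to her list in `P`. -/
def WomenWeaklyPrefer {n : ℕ} (P : Profile n) (μ μ' : Fin n ≃ Fin n) : Prop :=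
  ∀ w, (P.women w).WeaklyPrefers (μ.symm w) (μ'.symm w)

/-- Reporting `l` instead of his true list does not worsen the match of `m`. -/
def NoRegret {n : ℕ} (P : Profile n) (m : Fin n) (l : PrefList n) : Prop :=
  (P.men m).WeaklyPrefers (da (misreport P m l) m) (da P m)

/-- `l` is an optimal (no-regret) one-for-all strategy of the accomplice `m`. -/
def IsOptimal {n : ℕ} (P : Profile n) (m : Fin n) (l : PrefList n) : Prop :=
  NoRegret P m l ∧ WomenWeaklyPrefer P (da (misreport P m l)) (da P) ∧
    ∀ l', NoRegret P m l' →
      WomenWeaklyPrefer P (da (misreport P m l)) (da (misreport P m l'))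

open Classical in
/-- The women whom the strategy `l` pushes up: those below the deferred acceptance partner of `m`
in his true list and above that partner in `l`. -/
noncomputable def pushedUp {n : ℕ} (P : Profile n) (m : Fin n) (l : PrefList n) :
    Finset (Fin n) :=
  Finset.univ.filter (fun w => (P.men m).Prefers (da P m) w ∧ l.Prefers w (da P m))

/-- `l` is an optimal one-for-all strategy that pushes up as few women as possible. -/
def IsMinimumOptimal {n : ℕ} (P : Profile n) (m : Fin n) (l : PrefList n) : Prop :=
  IsOptimal P m l ∧ ∀ l', IsOptimal P m l' → (pushedUp P m l).card ≤ (pushedUp P m l').card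

/-- Push the set `X` above `a` in the list `l`: the new list is `(L ∪ X, a, R \ X)`, where `L` and
`R` are the parts of `l` above and below `a`; within each of the two parts the order is that of `l`.
(An element `a` of `X` is ignored.) -/
def PrefList.pushAbove {n : ℕ} (l : PrefList n) (a : Fin n) (X : Finset (Fin n)) :
    PrefList n where
  toList := l.toList.filter (fun w => w ≠ a ∧ (l.Prefers w a ∨ w ∈ X)) ++
    a :: l.toList.filter (fun w => w ≠ a ∧ ¬ (l.Prefers w a ∨ w ∈ X))
  nodup := by
    rw [List.nodup_append]
    refine ⟨l.nodup.filter _, ?_, ?_⟩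
    · rw [List.nodup_cons]
      exact ⟨by simp, l.nodup.filter _⟩
    · intro x hx y hy hxy
      subst hxy
      simp only [List.mem_filter, decide_eq_true_eq, List.mem_cons] at hx hy
      rcases hy with h | h
      · exact hx.2.1 h
      · exact h.2.2 hx.2.2
  mem := by
    intro w
    by_cases h : w = a
    · simp [h]
    · by_cases h' : l.Prefers w a ∨ w ∈ X
      · simp only [List.mem_append, List.mem_filter, decide_eq_true_eq]
        exact Or.inl ⟨l.mem w, h, h'⟩
      · simp only [List.mem_append, List.mem_filter, decide_eq_true_eq, List.mem_cons]
        exact Or.inr (Or.inr ⟨l.mem w, h, h'⟩)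

/-- The strategy of `m` that pushes up the set `X`, i.e. pushes it above the deferred acceptance
partner of `m` in his true list. -/
noncomputable def pushUp {n : ℕ} (P : Profile n) (m : Fin n) (X : Finset (Fin n)) : PrefList n :=
  (P.men m).pushAbove (da P m) X

/-- The matching after `m` pushes up the set `X`. -/
noncomputable def daPushUp {n : ℕ} (P : Profile n) (m : Fin n) (X : Finset (Fin n)) :
    Fin n ≃ Fin n :=
  da (misreport P m (pushUp P m X))

open Classical in
/-- The no-regret set: the women who cause no regret for `m` when pushed up individually. -/
noncomputable def noRegretSet {n : ℕ} (P : Profile n) (m : Fin n) : Finset (Fin n) :=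
  Finset.univ.filter (fun w => NoRegret P m (pushUp P m {w}))

/-- `Y` is a minimum no-regret push up set. -/
def IsMinimumNoRegretPushUpSet {n : ℕ} (P : Profile n) (m : Fin n) (Y : Finset (Fin n)) : Prop :=
  Y ⊆ noRegretSet P m ∧ daPushUp P m Y = daPushUp P m (noRegretSet P m) ∧
    ∀ Z ⊆ noRegretSet P m, daPushUp P m Z = daPushUp P m (noRegretSet P m) → Y.card ≤ Z.card

/-! ## The greedy algorithm, abstractly -/

/-- One successful check of the for-loop: some woman is removed from `Y` and the matching is
still the one obtained by pushing up the whole no-regret set. -/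
def GreedyStep {n : ℕ} (P : Profile n) (m : Fin n) (Y Y' : Finset (Fin n)) : Prop :=
  ∃ w ∈ Y, Y' = Y.erase w ∧ daPushUp P m Y' = daPushUp P m (noRegretSet P m)

/-- `Y` is a possible output of the greedy algorithm, which may go through the women of the current
set in any order: `Y` is reached from the no-regret set by successful removals, and every removal
from `Y` fails. -/
def GreedyReturns {n : ℕ} (P : Profile n) (m : Fin n) (Y : Finset (Fin n)) : Prop :=
  Relation.ReflTransGen (GreedyStep P m) (noRegretSet P m) Y ∧ ∀ Y', ¬ GreedyStep P m Y Y'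

/-! ## A random access machine, as a structured imperative language with running times

A state consists of registers and of two-dimensional tables holding natural numbers. An elementary
operation (reading a constant, a register or a table cell, successor, comparison, Boolean
connective, assignment, branching) costs one unit of time. As the successor is the only arithmetic
operation, no number can exceed the input and program constants by more than the elapsed time. -/

inductive Expr (R T : Type) where
  | const (k : ℕ)
  | reg (r : R)
  | cell (t : T) (i j : Expr R T)
  | succ (e : Expr R T)

inductive BExpr (R T : Type) where
  | lt (a b : Expr R T)
  | eq (a b : Expr R T)
  | not (b : BExpr R T)
  | or (b c : BExpr R T)
  | and (b c : BExpr R T)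

inductive Cmd (R T : Type) where
  | skip
  | set (r : R) (e : Expr R T)
  | store (t : T) (i j e : Expr R T)
  | seq (c d : Cmd R T)
  | ite (b : BExpr R T) (c d : Cmd R T)
  | while (b : BExpr R T) (c : Cmd R T)

structure State (R T : Type) where
  reg : R → ℕ
  tab : T → ℕ → ℕ → ℕ

def Expr.eval {R T : Type} (s : State R T) : Expr R T → ℕ
  | .const k => k
  | .reg r => s.reg r
  | .cell t i j => s.tab t (i.eval s) (j.eval s)
  | .succ e => e.eval s + 1

def Expr.cost {R T : Type} : Expr R T → ℕ
  | .const _ => 1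
  | .reg _ => 1
  | .cell _ i j => i.cost + j.cost + 1
  | .succ e => e.cost + 1

def BExpr.eval {R T : Type} (s : State R T) : BExpr R T → Bool
  | .lt a b => decide (a.eval s < b.eval s)
  | .eq a b => decide (a.eval s = b.eval s)
  | .not b => !b.eval s
  | .or b c => b.eval s || c.eval s
  | .and b c => b.eval s && c.eval s

def BExpr.cost {R T : Type} : BExpr R T → ℕ
  | .lt a b => a.cost + b.cost + 1
  | .eq a b => a.cost + b.cost + 1
  | .not b => b.cost + 1
  | .or b c => b.cost + c.cost + 1
  | .and b c => b.cost + c.cost + 1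

def State.setReg {R T : Type} [DecidableEq R] (s : State R T) (r : R) (v : ℕ) : State R T where
  reg := Function.update s.reg r v
  tab := s.tab

def State.setCell {R T : Type} [DecidableEq T] (s : State R T) (t : T) (i j v : ℕ) :
    State R T where
  reg := s.reg
  tab := Function.update s.tab t
    (Function.update (s.tab t) i (Function.update (s.tab t i) j v))

/-- `Exec c s s' t`: started in the state `s`, the command `c` terminates in the state `s'` after
exactly `t` units of time. -/
inductive Exec {R T : Type} [DecidableEq R] [DecidableEq T] :
    Cmd R T → State R T → State R T → ℕ → Prop where
  | skip (s : State R T) : Exec .skip s s 1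
  | set (s : State R T) (r : R) (e : Expr R T) :
      Exec (.set r e) s (s.setReg r (e.eval s)) (e.cost + 1)
  | store (s : State R T) (t : T) (i j e : Expr R T) :
      Exec (.store t i j e) s (s.setCell t (i.eval s) (j.eval s) (e.eval s))
        (i.cost + j.cost + e.cost + 1)
  | seq {c d : Cmd R T} {s s' s'' : State R T} {t t' : ℕ} :
      Exec c s s' t → Exec d s' s'' t' → Exec (.seq c d) s s'' (t + t')
  | ite_true {b : BExpr R T} {c d : Cmd R T} {s s' : State R T} {t : ℕ} :
      b.eval s = true → Exec c s s' t → Exec (.ite b c d) s s' (b.cost + 1 + t)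
  | ite_false {b : BExpr R T} {c d : Cmd R T} {s s' : State R T} {t : ℕ} :
      b.eval s = false → Exec d s s' t → Exec (.ite b c d) s s' (b.cost + 1 + t)
  | while_true {b : BExpr R T} {c : Cmd R T} {s s' s'' : State R T} {t t' : ℕ} :
      b.eval s = true → Exec c s s' t → Exec (.while b c) s' s'' t' →
        Exec (.while b c) s s'' (b.cost + 1 + t + t')
  | while_false {b : BExpr R T} {c : Cmd R T} {s : State R T} :
      b.eval s = false → Exec (.while b c) s s (b.cost + 1)

infixr:60 " ;; " => Cmd.seq

/-- `for r = 0, …, e - 1 do c`. -/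
def Cmd.for {R T : Type} (r : R) (e : Expr R T) (c : Cmd R T) : Cmd R T :=
  .set r (.const 0) ;; .while (.lt (.reg r) e) (c ;; .set r (.succ (.reg r)))

/-! ## The greedy algorithm as a program -/

/-- Registers. Input: the number `n` of men and the index `acc` of the accomplice. -/
inductive Reg where
  | n | acc | i | j | w | cur | active | h | a | r | pos | y | same
  deriving DecidableEq

/-- Tables. Input: `mp` and `wp`, the preference lists of the men and of the women (row = agent).
Output: `ys`, the indicator function of the current set, and `strat`, the list reported by the
accomplice. Work space: `rank`, the positions of the men in the women's lists; `mrank`, the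
positions of the women in the true list of the accomplice; `next`, the number of proposals made by
each man; `husb`, the current fiance of each woman (`n` if there is none); `nr`, the indicator
function of the no-regret set; `best`, the target matching. One-dimensional tables use row `0`. -/
inductive Tab where
  | mp | wp | ys | strat | rank | mrank | next | husb | nr | best
  deriving DecidableEq

namespace Program

/-- The value of a register. -/
abbrev v (r : Reg) : Expr Reg Tab := .reg r

/-- The entry of a one-dimensional table. -/
abbrev at1 (t : Tab) (e : Expr Reg Tab) : Expr Reg Tab := .cell t (.const 0) e

/-- Assignment to an entry of a one-dimensional table. -/
abbrev put1 (t : Tab) (i e : Expr Reg Tab) : Cmd Reg Tab := .store t (.const 0) i e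

/-- Compute the positions of the men in the women's lists and of the women in the list of the
accomplice; the accomplice initially reports his true list. -/
def prepare : Cmd Reg Tab :=
  .for .i (v .n) (.for .j (v .n) (.store .rank (v .i) (.cell .wp (v .i) (v .j)) (v .j))) ;;
  .for .j (v .n)
    (put1 .mrank (.cell .mp (v .acc) (v .j)) (v .j) ;;
     put1 .strat (v .j) (.cell .mp (v .acc) (v .j)))

/-- Deferred acceptance on the profile in which the accomplice reports `strat`: the men enter one
after the other, and the man who is currently free proposes. -/
def runDA : Cmd Reg Tab :=
  .for .i (v .n) (put1 .next (v .i) (.const 0) ;; put1 .husb (v .i) (v .n)) ;;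
  .for .i (v .n)
    (.set .cur (v .i) ;;
     .set .active (.const 1) ;;
     .while (.eq (v .active) (.const 1))
      (.ite (.eq (v .cur) (v .acc))
        (.set .w (at1 .strat (at1 .next (v .cur))))
        (.set .w (.cell .mp (v .cur) (at1 .next (v .cur)))) ;;
       put1 .next (v .cur) (.succ (at1 .next (v .cur))) ;;
       .set .h (at1 .husb (v .w)) ;;
       .ite (.eq (v .h) (v .n))
        (put1 .husb (v .w) (v .cur) ;; .set .active (.const 0))
        (.ite (.lt (.cell .rank (v .w) (v .cur)) (.cell .rank (v .w) (v .h)))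
          (put1 .husb (v .w) (v .cur) ;; .set .cur (v .h))
          .skip)))

/-- Store the partner of the accomplice in the register `r`. -/
def findPartner (r : Reg) : Cmd Reg Tab :=
  .for .i (v .n) (.ite (.eq (at1 .husb (v .i)) (v .acc)) (.set r (v .i)) .skip)

/-- The woman `w` is truly ranked above `a`, or belongs to the current set. -/
def goesUp : BExpr Reg Tab :=
  .or (.lt (at1 .mrank (v .w)) (at1 .mrank (v .a))) (.eq (at1 .ys (v .w)) (.const 1))

/-- Append the woman `e` to `strat`. -/
def append (e : Expr Reg Tab) : Cmd Reg Tab :=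
  put1 .strat (v .pos) e ;; .set .pos (.succ (v .pos))

/-- Let `strat` be the true list of the accomplice with the set `ys` pushed above `a`. -/
def buildPushUp : Cmd Reg Tab :=
  .set .pos (.const 0) ;;
  .for .i (v .n)
    (.set .w (.cell .mp (v .acc) (v .i)) ;;
     .ite (.and (.not (.eq (v .w) (v .a))) goesUp) (append (v .w)) .skip) ;;
  append (v .a) ;;
  .for .i (v .n)
    (.set .w (.cell .mp (v .acc) (v .i)) ;;
     .ite (.and (.not (.eq (v .w) (v .a))) (.not goesUp)) (append (v .w)) .skip)

/-- Compute the indicator function `nr` of the no-regret set. -/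
def computeNoRegretSet : Cmd Reg Tab :=
  .for .y (v .n) (put1 .ys (v .y) (.const 0)) ;;
  .for .y (v .n)
    (put1 .ys (v .y) (.const 1) ;;
     buildPushUp ;;
     runDA ;;
     findPartner .r ;;
     .ite (.lt (at1 .mrank (v .a)) (at1 .mrank (v .r)))
      (put1 .nr (v .y) (.const 0))
      (put1 .nr (v .y) (.const 1)) ;;
     put1 .ys (v .y) (.const 0))

/-- Let `same` be `1` if the current matching is `best`, and `0` otherwise. -/
def compare : Cmd Reg Tab :=
  .set .same (.const 1) ;;
  .for .i (v .n)
    (.ite (.eq (at1 .husb (v .i)) (at1 .best (v .i))) .skip (.set .same (.const 0)))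

/-- For each `y` in the current set: remove `y`, and check whether the matching changes; if it does
not, restart the loop with the smaller set, otherwise put `y` back and go on. -/
def greedyLoop : Cmd Reg Tab :=
  .set .y (.const 0) ;;
  .while (.lt (v .y) (v .n))
    (.ite (.eq (at1 .ys (v .y)) (.const 1))
      (put1 .ys (v .y) (.const 0) ;;
       buildPushUp ;;
       runDA ;;
       compare ;;
       .ite (.eq (v .same) (.const 1))
        (.set .y (.const 0))
        (put1 .ys (v .y) (.const 1) ;; .set .y (.succ (v .y))))
      (.set .y (.succ (v .y))))

/-- The whole algorithm: compute the true partner `a` of the accomplice, the no-regret set, and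
the matching `best` that results from pushing it up; run the greedy loop; write down the strategy
that pushes up the final set. -/
def main : Cmd Reg Tab :=
  prepare ;;
  runDA ;;
  findPartner .a ;;
  computeNoRegretSet ;;
  .for .y (v .n) (put1 .ys (v .y) (at1 .nr (v .y))) ;;
  buildPushUp ;;
  runDA ;;
  .for .i (v .n) (put1 .best (v .i) (at1 .husb (v .i))) ;;
  greedyLoop ;;
  buildPushUp

end Program

/-- The entry at position `j` of the list of agent `i`, as a number (`0` outside the range). -/
def encodeLists {n : ℕ} (f : Fin n → PrefList n) (i j : ℕ) : ℕ :=
  if hi : i < n then ((f ⟨i, hi⟩).toList[j]?).elim 0 (fun w => (w : ℕ)) else 0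

/-- The initial state for the profile `P` and the accomplice `m`; all work space is `0`. -/
def initState {n : ℕ} (P : Profile n) (m : Fin n) : State Reg Tab where
  reg := fun
    | .n => n
    | .acc => m
    | _ => 0
  tab := fun
    | .mp => encodeLists P.men
    | .wp => encodeLists P.women
    | _ => fun _ _ => 0

/-- The final state `s` exhibits the set `Y` and the strategy `l`. -/
def Outputs {n : ℕ} (s : State Reg Tab) (Y : Finset (Fin n)) (l : PrefList n) : Prop :=
  (∀ w : Fin n, s.tab .ys 0 w = if w ∈ Y then 1 else 0) ∧
    ∀ (k : ℕ) (w : Fin n), l.toList[k]? = some w → s.tab .strat 0 k = w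

end StableMarriage

open StableMarriage

/-!
A push-up set `X` inside the no-regret set never changes the partner of the accomplice, and among
the stable matchings in which he keeps this partner, `μ^X` is the worst one for the women in which
all women of `X` rebuff him, that is, would not leave their partners for him. Hence a woman of `X`
may be dropped as soon as she already rebuffs him when some of the other women of `X` are pushed up.
By the lattice of stable matchings a woman who rebuffs him in `μ^X` does so in `μ^∅` or in `μ^{x}`
for a single `x ∈ X`. So everything is governed by the relation that `u` rebuffs the accomplice in
`μ^{v}`. It is transitive, a set from which nothing can be removed is an antichain for it, and each
woman of such a set is related to a woman of any other push-up set with the same outcome, and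
conversely; thus a set that the greedy algorithm returns injects into every competitor.

For the running time, deferred acceptance with one proposal at a time takes `O(n ^ 2)` steps, since
no man proposes twice to the same woman. The greedy algorithm tries at most `n` women after each of
its at most `n` removals, which makes `O(n ^ 2)` runs of deferred acceptance.
-/

namespace StableMarriage

/-! ## Stable matchings -/

namespace PrefList

variable {n : ℕ} {l : PrefList n} {a b c : Fin n}

theorem weaklyPrefers_iff_le : l.WeaklyPrefers a b ↔ l.toList.idxOf a ≤ l.toList.idxOf b := by
  rw [le_iff_lt_or_eq]
  exact or_congr_right ⟨fun h => h ▸ rfl, l.idxOf_inj⟩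

theorem not_prefers : ¬ l.Prefers a b ↔ l.WeaklyPrefers b a := by
  rw [weaklyPrefers_iff_le]
  exact not_lt

theorem prefers_irrefl (l : PrefList n) (a : Fin n) : ¬ l.Prefers a a :=
  lt_irrefl _

theorem Prefers.ne (h : l.Prefers a b) : a ≠ b :=
  fun hab => l.prefers_irrefl b (hab ▸ h)

theorem WeaklyPrefers.antisymm (hab : l.WeaklyPrefers a b) (hba : l.WeaklyPrefers b a) : a = b :=
  l.idxOf_inj (le_antisymm (weaklyPrefers_iff_le.1 hab) (weaklyPrefers_iff_le.1 hba))

theorem WeaklyPrefers.trans (hab : l.WeaklyPrefers a b) (hbc : l.WeaklyPrefers b c) :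
    l.WeaklyPrefers a c :=
  weaklyPrefers_iff_le.2 ((weaklyPrefers_iff_le.1 hab).trans (weaklyPrefers_iff_le.1 hbc))

theorem WeaklyPrefers.trans_prefers (hab : l.WeaklyPrefers a b) (hbc : l.Prefers b c) :
    l.Prefers a c :=
  (weaklyPrefers_iff_le.1 hab).trans_lt hbc

theorem WeaklyPrefers.prefers_of_ne (hab : l.WeaklyPrefers a b) (hne : a ≠ b) : l.Prefers a b :=
  hab.resolve_right hne

end PrefList

section StableMatchings

variable {n : ℕ} {P : Profile n} {μ ν κ : Fin n ≃ Fin n}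

theorem WomenWeaklyPrefer.antisymm (hμν : WomenWeaklyPrefer P μ ν)
    (hνμ : WomenWeaklyPrefer P ν μ) : μ = ν :=
  Equiv.symm_bijective.injective (Equiv.ext fun w => (hμν w).antisymm (hνμ w))

/-- The woman `w`, matched according to `ν`, would not leave her partner for the man `j`. (She may
be matched with `j`.) -/
def Rebuffs (P : Profile n) (ν : Fin n ≃ Fin n) (w j : Fin n) : Prop :=
  (P.women w).WeaklyPrefers (ν.symm w) j

theorem Rebuffs.mono {w j : Fin n} (h : Rebuffs P ν w j) (hμν : WomenWeaklyPrefer P μ ν) :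
    Rebuffs P μ w j :=
  (hμν w).trans h

theorem rebuffs_partner (P : Profile n) (ν : Fin n ≃ Fin n) (j : Fin n) : Rebuffs P ν (ν j) j :=
  Or.inr (ν.symm_apply_apply j)

/-- A matching is stable if every man is rebuffed by all women whom he prefers to his partner. -/
def IsStable (P : Profile n) (ν : Fin n ≃ Fin n) : Prop :=
  ∀ j w, (P.men j).Prefers w (ν j) → Rebuffs P ν w j

theorem idxOf_da (P : Profile n) (j : Fin n) :
    (P.men j).toList.idxOf (da P j) = daState P j := by
  rw [← proposal_eq_some_iff]
  simp [da, daPartner]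

theorem da_isStable (P : Profile n) : IsStable P (da P) := by
  intro j w hjw
  have hrejected : (P.men j).toList.idxOf w < daState P j := by rwa [← idxOf_da]
  obtain ⟨b, hb, hbj⟩ := (daInvariant_iterate P (n * n)).2 j w hrejected
  have hbw : w = da P b := by
    apply (P.men b).idxOf_inj
    rw [idxOf_da]
    exact (proposal_eq_some_iff P _ b w).1 hb
  left
  rwa [hbw, Equiv.symm_apply_apply, ← hbw]

/-- `K` is closed in the sense that a man whose list is cut off after position `K j` survives at
that position, even against every man whose list reaches the same woman. -/
theorem daState_le_of_closed {K : Fin n → ℕ}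
    (hK : ∀ j w, (P.men j).toList.idxOf w = K j → ∀ j', (P.men j').toList.idxOf w ≤ K j' →
      (P.women w).WeaklyPrefers j j') (j : Fin n) : daState P j ≤ K j := by
  suffices h : ∀ t j, (daRound P)^[t] (fun _ => 0) j ≤ K j from h _ j
  intro t
  induction t with
  | zero => exact fun j => Nat.zero_le _
  | succ t ih =>
    intro j
    rw [Function.iterate_succ_apply']
    generalize (daRound P)^[t] (fun _ => 0) = k at ih
    unfold daRound
    split_ifs with hrej
    · obtain ⟨w, hw, j', hj', hp⟩ := hrej
      rw [proposal_eq_some_iff] at hw hj'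
      refine lt_of_le_of_ne (ih j) fun hk => ?_
      exact PrefList.not_prefers.2 (hK j w (hw.trans hk) j' (hj'.le.trans (ih j'))) hp
    · exact ih j

theorem da_manOptimal (hν : IsStable P ν) (j : Fin n) :
    (P.men j).WeaklyPrefers (da P j) (ν j) := by
  rw [PrefList.weaklyPrefers_iff_le, idxOf_da]
  refine daState_le_of_closed (K := fun j => (P.men j).toList.idxOf (ν j)) ?_ j
  intro j w hw j' hj'
  obtain rfl : w = ν j := (P.men j).idxOf_inj hw
  rw [← PrefList.weaklyPrefers_iff_le] at hj'
  rcases hj' with hprefers | heq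
  · simpa [Rebuffs] using hν j' _ hprefers
  · exact Or.inr (ν.injective heq)

theorem da_womanPessimal (hν : IsStable P ν) : WomenWeaklyPrefer P ν (da P) := by
  intro w
  have hman := da_manOptimal hν ((da P).symm w)
  rw [Equiv.apply_symm_apply] at hman
  rcases hman with hprefers | heq
  · exact hν _ _ hprefers
  · exact Or.inr (by rw [Equiv.symm_apply_eq]; exact heq)

/-! ## The join of two stable matchings -/

/-- The man whom the woman `w` likes better among her partners in `μ` and `ν`. -/
def betterPartner (P : Profile n) (μ ν : Fin n ≃ Fin n) (w : Fin n) : Fin n :=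
  if (P.women w).Prefers (μ.symm w) (ν.symm w) then μ.symm w else ν.symm w

theorem betterPartner_eq_or (P : Profile n) (μ ν : Fin n ≃ Fin n) (w : Fin n) :
    betterPartner P μ ν w = μ.symm w ∨ betterPartner P μ ν w = ν.symm w :=
  ite_eq_or_eq _ _ _

theorem betterPartner_weaklyPrefers_left (P : Profile n) (μ ν : Fin n ≃ Fin n) (w : Fin n) :
    (P.women w).WeaklyPrefers (betterPartner P μ ν w) (μ.symm w) := by
  unfold betterPartner
  split_ifs with h
  · exact Or.inr rfl
  · exact PrefList.not_prefers.1 h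

theorem betterPartner_weaklyPrefers_right (P : Profile n) (μ ν : Fin n ≃ Fin n) (w : Fin n) :
    (P.women w).WeaklyPrefers (betterPartner P μ ν w) (ν.symm w) := by
  unfold betterPartner
  split_ifs with h
  · exact Or.inl h
  · exact Or.inr rfl

/-- A man chosen by his partners in both matchings has only one partner: stability of the matching
in which he is worse off contradicts the choice of the other woman. -/
theorem IsStable.eq_of_betterPartner (hμ : IsStable P μ) (hν : IsStable P ν) {j : Fin n}
    (hμj : betterPartner P μ ν (μ j) = j) (hνj : betterPartner P μ ν (ν j) = j) : μ j = ν j := by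
  have hleft := betterPartner_weaklyPrefers_left P μ ν (ν j)
  have hright := betterPartner_weaklyPrefers_right P μ ν (μ j)
  rw [hνj] at hleft
  rw [hμj] at hright
  by_cases hprefers : (P.men j).Prefers (μ j) (ν j)
  · have heq := (hν j _ hprefers).antisymm hright
    exact (Equiv.symm_apply_eq ν).1 heq
  · rcases PrefList.not_prefers.1 hprefers with hlt | heq
    · exact ((Equiv.symm_apply_eq μ).1 ((hμ j _ hlt).antisymm hleft)).symm
    · exact heq.symm

theorem IsStable.betterPartner_bijective (hμ : IsStable P μ) (hν : IsStable P ν) :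
    Function.Bijective (betterPartner P μ ν) := by
  refine Function.Injective.bijective_of_finite fun w w' heq => ?_
  obtain ⟨j, hj⟩ : ∃ j, betterPartner P μ ν w = j := ⟨_, rfl⟩
  have hj' := heq ▸ hj
  rcases betterPartner_eq_or P μ ν w with hw | hw <;>
    rcases betterPartner_eq_or P μ ν w' with hw' | hw' <;>
    rw [hj, eq_comm, Equiv.symm_apply_eq] at hw <;>
    rw [hj', eq_comm, Equiv.symm_apply_eq] at hw' <;>
    subst hw hw'
  · rfl
  · exact hμ.eq_of_betterPartner hν hj hj'
  · exact (hμ.eq_of_betterPartner hν hj' hj).symm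
  · rfl

/-- The matching in which every woman gets the better one of her partners in two stable
matchings. -/
noncomputable def IsStable.join (hμ : IsStable P μ) (hν : IsStable P ν) : Fin n ≃ Fin n :=
  (Equiv.ofBijective _ (hμ.betterPartner_bijective hν)).symm

theorem IsStable.join_symm_apply (hμ : IsStable P μ) (hν : IsStable P ν) (w : Fin n) :
    (hμ.join hν).symm w = betterPartner P μ ν w :=
  rfl

theorem IsStable.join_apply_eq_or (hμ : IsStable P μ) (hν : IsStable P ν) (j : Fin n) :
    hμ.join hν j = μ j ∨ hμ.join hν j = ν j := by
  have h := betterPartner_eq_or P μ ν (hμ.join hν j)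
  rw [← hμ.join_symm_apply hν, Equiv.symm_apply_apply] at h
  exact h.imp (fun h => (μ.eq_symm_apply.1 h).symm) (fun h => (ν.eq_symm_apply.1 h).symm)

theorem IsStable.join_womenWeaklyPrefer_left (hμ : IsStable P μ) (hν : IsStable P ν) :
    WomenWeaklyPrefer P (hμ.join hν) μ :=
  betterPartner_weaklyPrefers_left P μ ν

theorem IsStable.join_womenWeaklyPrefer_right (hμ : IsStable P μ) (hν : IsStable P ν) :
    WomenWeaklyPrefer P (hμ.join hν) ν :=
  betterPartner_weaklyPrefers_right P μ ν

theorem IsStable.join_isStable (hμ : IsStable P μ) (hν : IsStable P ν) :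
    IsStable P (hμ.join hν) := by
  intro j w hjw
  rcases hμ.join_apply_eq_or hν j with heq | heq <;> rw [heq] at hjw
  · exact (hμ j w hjw).mono (hμ.join_womenWeaklyPrefer_left hν)
  · exact (hν j w hjw).mono (hμ.join_womenWeaklyPrefer_right hν)

end StableMatchings

/-! ## Strategyproofness -/

section Strategyproofness

variable {n : ℕ} {P : Profile n}

theorem exists_favourite_proposal {k : Fin n → ℕ} {j w : Fin n} (hj : proposal P k j = some w) :
    ∃ b, proposal P k b = some w ∧ ¬ Rejected P k b ∧ (P.women w).WeaklyPrefers b j := by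
  obtain ⟨b, hb, hmin⟩ := Finset.exists_min_image
    (Finset.univ.filter fun b => proposal P k b = some w)
    (fun b => (P.women w).toList.idxOf b) ⟨j, by simp [hj]⟩
  simp only [Finset.mem_filter, Finset.mem_univ, true_and] at hb hmin
  refine ⟨b, hb, ?_, PrefList.weaklyPrefers_iff_le.2 (hmin j hj)⟩
  rintro ⟨w', hw', b', hb', hprefers⟩
  obtain rfl : w = w' := Option.some.inj (hb.symm.trans hw')
  exact (hmin b' hb').not_gt hprefers

theorem exists_preferred_proposal {k : Fin n → ℕ} (hk : DAInvariant P k) {j w : Fin n}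
    (hj : (P.men j).toList.idxOf w < daRound P k j) :
    ∃ b, proposal P k b = some w ∧ ¬ Rejected P k b ∧ (P.women w).Prefers b j := by
  obtain ⟨b₀, hb₀, hb₀j⟩ : ∃ b, proposal P k b = some w ∧ (P.women w).Prefers b j := by
    by_cases hlt : (P.men j).toList.idxOf w < k j
    · exact hk.2 j w hlt
    · unfold daRound at hj
      split_ifs at hj with hrej
      · obtain ⟨w', hw', b, hb⟩ := hrej
        rw [proposal_eq_some_iff] at hw'
        obtain rfl : w = w' := (P.men j).idxOf_inj (by omega)
        exact ⟨b, hb⟩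
      · contradiction
  obtain ⟨b, hb, hrej, hbb₀⟩ := exists_favourite_proposal hb₀
  exact ⟨b, hb, hrej, hbb₀.trans_prefers hb₀j⟩

theorem iterate_daRound_le_daState (P : Profile n) (t : ℕ) (j : Fin n) :
    (daRound P)^[t] (fun _ => 0) j ≤ daState P j := by
  rcases le_total t (n * n) with ht | ht
  · have hmono : Monotone fun t => (daRound P)^[t] (fun _ => 0) j :=
      monotone_nat_of_le_succ fun t => by
        rw [Function.iterate_succ_apply']
        exact le_daRound P _ j
    exact hmono ht
  · obtain ⟨s, rfl⟩ := Nat.exists_eq_add_of_le' ht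
    rw [Function.iterate_add_apply]
    exact (congrFun (Function.iterate_fixed (daRound_daState P) s) j).le

/-- The hypothesis of the blocking lemma: a pair that blocks `ν` contains a man who likes `ν` better
than the outcome of deferred acceptance. -/
def BlockedOnlyByImproved (P : Profile n) (ν : Fin n ≃ Fin n) : Prop :=
  ∀ j w, (P.men j).Prefers w (ν j) → Rebuffs P ν w j ∨ (P.men j).Prefers (ν j) (da P j)

namespace BlockedOnlyByImproved

variable {ν : Fin n ≃ Fin n}

/-- The men who improve on deferred acceptance exchange their partners among themselves, since the
former partner of an improving man would otherwise form a blocking pair. -/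
theorem exists_improved_partner (hν : BlockedOnlyByImproved P ν) {i : Fin n}
    (hi : (P.men i).Prefers (ν i) (da P i)) :
    ∃ j, (P.men j).Prefers (ν j) (da P j) ∧ ν j = da P i := by
  let σ : Equiv.Perm (Fin n) := ν.trans (da P).symm
  have hσ : Set.MapsTo σ {j | (P.men j).Prefers (ν j) (da P j)}
      {j | (P.men j).Prefers (ν j) (da P j)} := by
    intro j hj
    have hpartner : da P (σ j) = ν j := by simp [σ]
    by_contra hnot
    have hne : j ≠ σ j := fun h => hnot (h ▸ hj)
    have hprefers : (P.men (σ j)).Prefers (ν j) (ν (σ j)) := by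
      rw [← hpartner]
      refine (PrefList.not_prefers.1 hnot).prefers_of_ne fun h => hne (ν.injective ?_)
      rw [← h, hpartner]
    have hwoman : (P.women (ν j)).WeaklyPrefers j (σ j) := by
      simpa [Rebuffs] using (hν (σ j) (ν j) hprefers).resolve_right hnot
    have hrebuffs : (P.women (ν j)).WeaklyPrefers (σ j) j := by
      simpa [Rebuffs, σ] using da_isStable P j (ν j) hj
    exact hne (hwoman.antisymm hrebuffs)
  exact ⟨σ.symm i, Equiv.Perm.perm_symm_mapsTo_of_mapsTo _ hσ hi, by simp [σ]⟩

/-- Were `i` to make his final proposal only in round `t + 1`, a man `b` displaced from `da P i`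
by it would block `ν`. -/
theorem eq_daState_of_succ (hν : BlockedOnlyByImproved P ν) {t : ℕ}
    (hfinal : ∀ j, (P.men j).Prefers (ν j) (da P j) →
      (daRound P)^[t + 1] (fun _ => 0) j = daState P j) {i : Fin n}
    (hi : (P.men i).Prefers (ν i) (da P i)) :
    (daRound P)^[t] (fun _ => 0) i = daState P i := by
  have hinv := daInvariant_iterate P t
  have hle := iterate_daRound_le_daState P t
  simp only [Function.iterate_succ_apply'] at hfinal
  generalize (daRound P)^[t] (fun _ => 0) = k at hinv hle hfinal ⊢
  by_contra hik
  obtain ⟨j, hj, hji⟩ := hν.exists_improved_partner hi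
  have hpassed : (P.men j).toList.idxOf (da P i) < daRound P k j := by
    rw [hfinal j hj, ← idxOf_da, ← hji]
    exact hj
  obtain ⟨b, hb, hrej, hbj⟩ := exists_preferred_proposal hinv hpassed
  rw [proposal_eq_some_iff] at hb
  have hbi : b ≠ i := by
    rintro rfl
    exact hik (hb.symm.trans (idxOf_da P b))
  have hb_not : ¬ (P.men b).Prefers (ν b) (da P b) := by
    intro himp
    have hkb := hfinal b himp
    rw [daRound, if_neg hrej, ← hb, ← idxOf_da] at hkb
    exact hbi ((da P).injective ((P.men b).idxOf_inj hkb)).symm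
  have hweak : (P.men b).WeaklyPrefers (da P i) (da P b) := by
    rw [PrefList.weaklyPrefers_iff_le, hb, idxOf_da]
    exact hle b
  have hblocks : (P.men b).Prefers (da P i) (ν b) := by
    refine (hweak.trans (PrefList.not_prefers.1 hb_not)).prefers_of_ne fun heq => hb_not ?_
    rwa [← ν.injective (hji.trans heq)]
  refine (hν b _ hblocks).elim (fun hrebuffs => ?_) hb_not
  rw [Rebuffs, ← hji, Equiv.symm_apply_apply, hji] at hrebuffs
  exact PrefList.not_prefers.2 hrebuffs hbj

/-- The blocking lemma of Gale and Sotomayor. -/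
theorem da_weaklyPrefers (hν : BlockedOnlyByImproved P ν) (i : Fin n) :
    (P.men i).WeaklyPrefers (da P i) (ν i) := by
  rw [← PrefList.not_prefers]
  intro hi
  have hstart : ∀ t, (∀ j, (P.men j).Prefers (ν j) (da P j) →
      (daRound P)^[t] (fun _ => 0) j = daState P j) →
      ∀ j, (P.men j).Prefers (ν j) (da P j) → 0 = daState P j := by
    intro t
    induction t with
    | zero => exact id
    | succ t ih => exact fun hfinal => ih fun j hj => hν.eq_daState_of_succ hfinal hj
  have hzero := hstart (n * n) (fun _ _ => rfl) i hi
  rw [PrefList.Prefers, idxOf_da, ← hzero] at hi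
  exact Nat.not_lt_zero _ hi

end BlockedOnlyByImproved

theorem misreport_misreport (P : Profile n) (m : Fin n) (l l' : PrefList n) :
    misreport (misreport P m l) m l' = misreport P m l' := by
  simp [misreport]

theorem misreport_self (P : Profile n) (m : Fin n) : misreport P m (P.men m) = P := by
  simp [misreport]

theorem da_strategyproof (P : Profile n) (m : Fin n) (l : PrefList n) :
    (P.men m).WeaklyPrefers (da P m) (da (misreport P m l) m) := by
  rw [← PrefList.not_prefers]
  intro himproves
  refine PrefList.not_prefers.2 (BlockedOnlyByImproved.da_weaklyPrefers (fun j w hjw => ?_) m)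
    himproves
  by_cases hjm : j = m
  · exact Or.inr (hjm ▸ himproves)
  · exact Or.inl (da_isStable (misreport P m l) j w (by simpa [misreport, hjm] using hjw))

theorem da_misreport_strategyproof (P : Profile n) (m : Fin n) (l l' : PrefList n) :
    l.WeaklyPrefers (da (misreport P m l) m) (da (misreport P m l') m) := by
  have h := da_strategyproof (misreport P m l) m l'
  rw [misreport_misreport] at h
  simpa [misreport] using h

theorem noRegret_iff {m : Fin n} {l : PrefList n} :
    NoRegret P m l ↔ da (misreport P m l) m = da P m :=
  ⟨fun h => h.antisymm (da_strategyproof P m l), Or.inr⟩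

end Strategyproofness

/-! ## Push-up strategies -/

section PushUp

variable {n : ℕ} {P : Profile n} {m : Fin n} {l l' : PrefList n} {ν : Fin n ≃ Fin n}
  {X Y Z : Finset (Fin n)}

theorem IsStable.rebuffs_of_misreport (hν : IsStable (misreport P m l) ν) {w : Fin n}
    (hw : l.Prefers w (ν m)) : Rebuffs P ν w m :=
  hν m w (by simpa [misreport] using hw)

theorem IsStable.misreport_congr (hν : IsStable (misreport P m l) ν)
    (h : ∀ w, l'.Prefers w (ν m) → Rebuffs P ν w m) : IsStable (misreport P m l') ν := by
  intro j w hjw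
  by_cases hjm : j = m
  · subst hjm
    exact h w (by simpa [misreport] using hjw)
  · exact hν j w (by simpa [misreport, hjm] using hjw)

theorem PrefList.pushAbove_prefers_iff (l : PrefList n) (a : Fin n) (X : Finset (Fin n))
    (w : Fin n) : (l.pushAbove a X).Prefers w a ↔ w ≠ a ∧ (l.Prefers w a ∨ w ∈ X) := by
  set L := l.toList.filter fun w => w ≠ a ∧ (l.Prefers w a ∨ w ∈ X)
  have ha : a ∉ L := by simp [L]
  have hmem : w ∈ L ↔ w ≠ a ∧ (l.Prefers w a ∨ w ∈ X) := by simp [L, l.mem w]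
  change (L ++ a :: _).idxOf w < (L ++ a :: _).idxOf a ↔ _
  rw [List.idxOf_append_of_notMem ha, List.idxOf_cons_self, Nat.add_zero]
  by_cases hw : w ∈ L
  · rw [List.idxOf_append_of_mem hw]
    exact iff_of_true (List.idxOf_lt_length_of_mem hw) (hmem.1 hw)
  · rw [List.idxOf_append_of_notMem hw]
    exact iff_of_false (by omega) fun h => hw (hmem.2 h)

theorem pushUp_prefers_iff {w : Fin n} : (pushUp P m X).Prefers w (da P m) ↔
    w ≠ da P m ∧ ((P.men m).Prefers w (da P m) ∨ w ∈ X) :=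
  PrefList.pushAbove_prefers_iff _ _ _ _

/-- The woman `w` is an option of the accomplice `m` if some report matches him with her. -/
def IsOption (P : Profile n) (m w : Fin n) : Prop :=
  ∃ l, da (misreport P m l) m = w

theorem isOption_da (P : Profile n) (m : Fin n) : IsOption P m (da P m) :=
  ⟨P.men m, by rw [misreport_self]⟩

theorem da_misreport_eq_of_isOption {a : Fin n} (ha : IsOption P m a)
    (hbest : ∀ w, IsOption P m w → l.WeaklyPrefers a w) : da (misreport P m l) m = a := by
  refine PrefList.WeaklyPrefers.antisymm (l := l) ?_ (hbest _ ⟨l, rfl⟩)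
  obtain ⟨l', rfl⟩ := ha
  exact da_misreport_strategyproof P m l l'

theorem da_misreport_pushUp_eq (hX : ∀ w ∈ X, IsOption P m w → w = da P m) :
    da (misreport P m (pushUp P m X)) m = da P m := by
  refine da_misreport_eq_of_isOption (isOption_da P m) fun w hw => ?_
  rw [← PrefList.not_prefers, pushUp_prefers_iff]
  rintro ⟨hne, hprefers | hmem⟩
  · obtain ⟨l', rfl⟩ := hw
    exact PrefList.not_prefers.2 (da_strategyproof P m l') hprefers
  · exact hne (hX w hmem hw)

theorem mem_noRegretSet {w : Fin n} : w ∈ noRegretSet P m ↔ NoRegret P m (pushUp P m {w}) := by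
  simp only [noRegretSet, Finset.mem_filter, Finset.mem_univ, true_and]

theorem mem_noRegretSet_iff {w : Fin n} :
    w ∈ noRegretSet P m ↔ (IsOption P m w → w = da P m) := by
  rw [mem_noRegretSet, noRegret_iff]
  constructor
  · rintro h ⟨l', hl'⟩
    by_contra hne
    have hprefers := da_misreport_strategyproof P m (pushUp P m {w}) l'
    rw [h, hl'] at hprefers
    exact PrefList.not_prefers.2 hprefers
      (pushUp_prefers_iff.2 ⟨hne, Or.inr (Finset.mem_singleton_self w)⟩)
  · intro h
    refine da_misreport_pushUp_eq fun w' hw' => ?_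
    rwa [Finset.mem_singleton.1 hw']

theorem daPushUp_apply (hX : X ⊆ noRegretSet P m) : daPushUp P m X m = da P m :=
  da_misreport_pushUp_eq fun _ hw => mem_noRegretSet_iff.1 (hX hw)

theorem noRegret_pushUp (hX : X ⊆ noRegretSet P m) : NoRegret P m (pushUp P m X) :=
  noRegret_iff.2 (daPushUp_apply hX)

theorem mem_pushedUp_iff {w : Fin n} :
    w ∈ pushedUp P m l ↔ (P.men m).Prefers (da P m) w ∧ l.Prefers w (da P m) := by
  simp [pushedUp]

theorem pushedUp_pushUp_subset : pushedUp P m (pushUp P m X) ⊆ X := by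
  intro w hw
  rw [mem_pushedUp_iff, pushUp_prefers_iff] at hw
  exact hw.2.2.resolve_left (lt_asymm hw.1)

theorem NoRegret.pushedUp_subset (hl : NoRegret P m l) : pushedUp P m l ⊆ noRegretSet P m := by
  intro w hw
  rw [mem_noRegretSet_iff]
  rintro ⟨l', hl'⟩
  have hle := da_misreport_strategyproof P m l l'
  rw [hl', noRegret_iff.1 hl] at hle
  exact absurd (mem_pushedUp_iff.1 hw).2 (PrefList.not_prefers.2 hle)

/-- The stable matchings in which the accomplice `m` keeps his deferred acceptance partner and is
rebuffed by all women of `X`. -/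
def rebuffStable (P : Profile n) (m : Fin n) (X : Finset (Fin n)) : Set (Fin n ≃ Fin n) :=
  {ν | IsStable P ν ∧ ν m = da P m ∧ ∀ w ∈ X, Rebuffs P ν w m}

theorem rebuffStable_antitone (hXY : X ⊆ Y) : rebuffStable P m Y ⊆ rebuffStable P m X :=
  fun _ hν => ⟨hν.1, hν.2.1, fun w hw => hν.2.2 w (hXY hw)⟩

theorem daPushUp_mem_rebuffStable (hX : X ⊆ noRegretSet P m) :
    daPushUp P m X ∈ rebuffStable P m X := by
  have hstable : IsStable (misreport P m (pushUp P m X)) (daPushUp P m X) := da_isStable _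
  have hpartner := daPushUp_apply hX
  have hrebuffs : ∀ w, ((P.men m).Prefers w (da P m) ∨ w ∈ X) →
      Rebuffs P (daPushUp P m X) w m := by
    intro w hw
    by_cases hne : w = da P m
    · rw [hne, ← hpartner]
      exact rebuffs_partner _ _ _
    · apply hstable.rebuffs_of_misreport
      rw [hpartner]
      exact pushUp_prefers_iff.2 ⟨hne, hw⟩
  refine ⟨?_, hpartner, fun w hw => hrebuffs w (Or.inr hw)⟩
  have htruth : IsStable (misreport P m (P.men m)) (daPushUp P m X) :=
    hstable.misreport_congr fun w hw => hrebuffs w (Or.inl (hpartner ▸ hw))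
  rwa [misreport_self] at htruth

theorem womenWeaklyPrefer_daPushUp (hν : ν ∈ rebuffStable P m X) :
    WomenWeaklyPrefer P ν (daPushUp P m X) := by
  obtain ⟨hstable, hpartner, hX⟩ := hν
  refine da_womanPessimal (P := misreport P m (pushUp P m X))
    (IsStable.misreport_congr (l := P.men m) ((misreport_self P m).symm ▸ hstable) fun w hw => ?_)
  rw [hpartner, pushUp_prefers_iff] at hw
  exact hw.2.elim (fun hprefers => hstable m w (hpartner ▸ hprefers)) (hX w)

theorem daPushUp_mono (hXY : X ⊆ Y) (hY : Y ⊆ noRegretSet P m) :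
    WomenWeaklyPrefer P (daPushUp P m Y) (daPushUp P m X) :=
  womenWeaklyPrefer_daPushUp (rebuffStable_antitone hXY (daPushUp_mem_rebuffStable hY))

/-! ## Optimal strategies -/

theorem daPushUp_womenWeaklyPrefer_misreport (hlX : pushedUp P m l ⊆ X) (hX : X ⊆ noRegretSet P m) :
    WomenWeaklyPrefer P (daPushUp P m X) (da (misreport P m l)) := by
  obtain ⟨hstable, hpartner, hrebuffs⟩ := daPushUp_mem_rebuffStable hX
  refine da_womanPessimal (P := misreport P m l)
    (IsStable.misreport_congr (l := P.men m) ((misreport_self P m).symm ▸ hstable) fun w hw => ?_)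
  by_cases hprefers : (P.men m).Prefers w (daPushUp P m X m)
  · exact hstable m w hprefers
  · rw [hpartner] at hw hprefers
    exact hrebuffs w (hlX (mem_pushedUp_iff.2
      ⟨(PrefList.not_prefers.1 hprefers).prefers_of_ne hw.ne.symm, hw⟩))

theorem isOptimal_iff (hl : NoRegret P m l) :
    IsOptimal P m l ↔ da (misreport P m l) = daPushUp P m (noRegretSet P m) := by
  have hbest : ∀ l', NoRegret P m l' →
      WomenWeaklyPrefer P (daPushUp P m (noRegretSet P m)) (da (misreport P m l')) :=
    fun l' hl' => daPushUp_womenWeaklyPrefer_misreport hl'.pushedUp_subset subset_rfl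
  constructor
  · rintro ⟨-, -, hopt⟩
    exact (hopt _ (noRegret_pushUp subset_rfl)).antisymm (hbest l hl)
  · intro heq
    rw [IsOptimal, heq]
    have htruth := hbest (P.men m) (noRegret_iff.2 (by rw [misreport_self]))
    rw [misreport_self] at htruth
    exact ⟨hl, htruth, hbest⟩

theorem IsMinimumNoRegretPushUpSet.isMinimumOptimal (hY : IsMinimumNoRegretPushUpSet P m Y) :
    IsMinimumOptimal P m (pushUp P m Y) := by
  obtain ⟨hYsub, hYeq, hYmin⟩ := hY
  refine ⟨(isOptimal_iff (noRegret_pushUp hYsub)).2 hYeq, fun l hl => ?_⟩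
  have hsub := hl.1.pushedUp_subset
  have hpushedUp : daPushUp P m (pushedUp P m l) = daPushUp P m (noRegretSet P m) := by
    refine WomenWeaklyPrefer.antisymm (P := P) ?_ (daPushUp_mono hsub subset_rfl)
    rw [← (isOptimal_iff hl.1).1 hl]
    exact daPushUp_womenWeaklyPrefer_misreport subset_rfl hsub
  exact (Finset.card_le_card pushedUp_pushUp_subset).trans (hYmin _ hsub hpushedUp)

/-! ## Minimality of the sets returned by the greedy algorithm -/

theorem join_mem_rebuffStable {μ : Fin n ≃ Fin n} (hμ : μ ∈ rebuffStable P m X)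
    (hν : ν ∈ rebuffStable P m Y) : hμ.1.join hν.1 ∈ rebuffStable P m (X ∪ Y) := by
  refine ⟨hμ.1.join_isStable hν.1, ?_, fun w hw => ?_⟩
  · exact (hμ.1.join_apply_eq_or hν.1 m).elim (·.trans hμ.2.1) (·.trans hν.2.1)
  · rcases Finset.mem_union.1 hw with hw | hw
    · exact (hμ.2.2 w hw).mono (hμ.1.join_womenWeaklyPrefer_left hν.1)
    · exact (hν.2.2 w hw).mono (hμ.1.join_womenWeaklyPrefer_right hν.1)

theorem rebuffs_daPushUp_union (hX : X ⊆ noRegretSet P m) (hY : Y ⊆ noRegretSet P m) {w : Fin n}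
    (hw : Rebuffs P (daPushUp P m (X ∪ Y)) w m) :
    Rebuffs P (daPushUp P m X) w m ∨ Rebuffs P (daPushUp P m Y) w m := by
  have hμ := daPushUp_mem_rebuffStable hX
  have hν := daPushUp_mem_rebuffStable hY
  have hjoin : Rebuffs P (hμ.1.join hν.1) w m :=
    hw.mono (womenWeaklyPrefer_daPushUp (join_mem_rebuffStable hμ hν))
  rw [Rebuffs, IsStable.join_symm_apply] at hjoin
  rcases betterPartner_eq_or P (daPushUp P m X) (daPushUp P m Y) w with heq | heq <;>
    rw [heq] at hjoin
  · exact Or.inl hjoin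
  · exact Or.inr hjoin

theorem rebuffs_empty_or_singleton (hX : X ⊆ noRegretSet P m) {w : Fin n}
    (hw : Rebuffs P (daPushUp P m X) w m) :
    Rebuffs P (daPushUp P m ∅) w m ∨ ∃ x ∈ X, Rebuffs P (daPushUp P m {x}) w m := by
  induction X using Finset.induction_on with
  | empty => exact Or.inl hw
  | insert x X _ ih =>
    obtain ⟨hx, hX⟩ := Finset.insert_subset_iff.1 hX
    rw [Finset.insert_eq] at hw
    rcases rebuffs_daPushUp_union (Finset.singleton_subset_iff.2 hx) hX hw with hw | hw
    · exact Or.inr ⟨x, Finset.mem_insert_self x X, hw⟩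
    · exact (ih hX hw).imp_right fun ⟨y, hy, hwy⟩ => ⟨y, Finset.mem_insert_of_mem hy, hwy⟩

theorem daPushUp_erase_eq (hY : Y ⊆ noRegretSet P m) {y : Fin n} (hZ : Z ⊆ Y.erase y)
    (hy : Rebuffs P (daPushUp P m Z) y m) : daPushUp P m (Y.erase y) = daPushUp P m Y := by
  have herase := (Y.erase_subset y).trans hY
  obtain ⟨hstable, hpartner, hrebuffs⟩ := daPushUp_mem_rebuffStable herase
  refine WomenWeaklyPrefer.antisymm (P := P) ?_ (daPushUp_mono (Y.erase_subset y) hY)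
  refine womenWeaklyPrefer_daPushUp ⟨hstable, hpartner, fun w hw => ?_⟩
  by_cases hwy : w = y
  · subst hwy
    exact hy.mono (daPushUp_mono hZ herase)
  · exact hrebuffs w (Finset.mem_erase.2 ⟨hwy, hw⟩)

/-- Pushing up the woman `v` of the no-regret set on her own makes the woman `u` rebuff `m`. -/
def CoveredBy (P : Profile n) (m u v : Fin n) : Prop :=
  v ∈ noRegretSet P m ∧ Rebuffs P (daPushUp P m {v}) u m

theorem CoveredBy.trans {u v w : Fin n} (huv : CoveredBy P m u v) (hvw : CoveredBy P m v w) :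
    CoveredBy P m u w := by
  obtain ⟨hstable, hpartner, -⟩ :=
    daPushUp_mem_rebuffStable (Finset.singleton_subset_iff.2 hvw.1)
  have hw : daPushUp P m {w} ∈ rebuffStable P m {v} := by
    refine ⟨hstable, hpartner, fun x hx => ?_⟩
    rw [Finset.mem_singleton.1 hx]
    exact hvw.2
  exact ⟨hvw.1, huv.2.mono (womenWeaklyPrefer_daPushUp hw)⟩

end PushUp

theorem card_le_card_of_isAntichain {α : Type*} {r : α → α → Prop} {Y Z : Finset α}
    (htrans : ∀ ⦃a b c⦄, r a b → r b c → r a c) (hY : IsAntichain r (Y : Set α))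
    (hYZ : ∀ y ∈ Y, ∃ z ∈ Z, r y z ∧ ∃ y' ∈ Y, r z y') : Y.card ≤ Z.card := by
  choose! f hfZ hf g hgY hg using hYZ
  have hback : ∀ y ∈ Y, ∀ y' ∈ Y, f y = f y' → y = g y' := fun y hy y' hy' heq =>
    hY.eq hy (hgY y' hy') (htrans (hf y hy) (heq ▸ hg y' hy'))
  refine Finset.card_le_card_of_injOn f hfZ fun y hy y' hy' heq => ?_
  rw [hback y hy y' hy' heq, ← hback y' hy' y' hy' rfl]

section Greedy

variable {n : ℕ} {P : Profile n} {m : Fin n} {Y Z : Finset (Fin n)}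

/-- The women of an irredundant set `Y` form an antichain for `CoveredBy P m`, and each of them is
covered by a woman of `Z` who in turn is covered by a woman of `Y`. -/
theorem card_le_card_of_daPushUp_eq (hY : Y ⊆ noRegretSet P m) (hZ : Z ⊆ noRegretSet P m)
    (hYZ : daPushUp P m Y = daPushUp P m Z)
    (hirredundant : ∀ y ∈ Y, daPushUp P m (Y.erase y) ≠ daPushUp P m Y) : Y.card ≤ Z.card := by
  have hempty : ∀ y ∈ Y, ¬ Rebuffs P (daPushUp P m ∅) y m := fun y hy h =>
    hirredundant y hy (daPushUp_erase_eq hY (Finset.empty_subset _) h)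
  have hcovered : ∀ X ⊆ noRegretSet P m, ∀ w, Rebuffs P (daPushUp P m X) w m →
      ¬ Rebuffs P (daPushUp P m ∅) w m → ∃ x ∈ X, CoveredBy P m w x := fun X hX w hw hw_empty => by
    obtain ⟨x, hx, hwx⟩ := (rebuffs_empty_or_singleton hX hw).resolve_left hw_empty
    exact ⟨x, hx, hX hx, hwx⟩
  refine card_le_card_of_isAntichain (r := CoveredBy P m) (fun _ _ _ => CoveredBy.trans)
    (fun y hy y' hy' hne hyy' => ?_) fun y hy => ?_
  · refine hirredundant y hy (daPushUp_erase_eq hY (Z := {y'}) ?_ hyy'.2)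
    exact Finset.singleton_subset_iff.2 (Finset.mem_erase.2 ⟨hne.symm, hy'⟩)
  · have hyZ := hYZ ▸ (daPushUp_mem_rebuffStable hY).2.2 y hy
    obtain ⟨z, hz, hyz⟩ := hcovered Z hZ y hyZ (hempty y hy)
    refine ⟨z, hz, hyz, ?_⟩
    have hzY := hYZ.symm ▸ (daPushUp_mem_rebuffStable hZ).2.2 z hz
    by_cases hz_empty : Rebuffs P (daPushUp P m ∅) z m
    · have hyY := Finset.singleton_subset_iff.2 (hY hy)
      exact ⟨y, hy, hY hy, hz_empty.mono (daPushUp_mono (Finset.empty_subset _) hyY)⟩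
    · exact hcovered Y hY z hzY hz_empty

theorem GreedyReturns.isMinimumNoRegretPushUpSet (hY : GreedyReturns P m Y) :
    IsMinimumNoRegretPushUpSet P m Y := by
  obtain ⟨hreach, hterminal⟩ := hY
  have hinv : Y ⊆ noRegretSet P m ∧ daPushUp P m Y = daPushUp P m (noRegretSet P m) := by
    clear hterminal
    induction hreach with
    | refl => exact ⟨subset_rfl, rfl⟩
    | tail _ hstep ih =>
      obtain ⟨w, -, rfl, heq⟩ := hstep
      exact ⟨(Finset.erase_subset _ _).trans ih.1, heq⟩
  refine ⟨hinv.1, hinv.2, fun Z hZ hZeq => ?_⟩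
  refine card_le_card_of_daPushUp_eq hinv.1 hZ (hinv.2.trans hZeq.symm) fun y hy heq => ?_
  exact hterminal _ ⟨y, hy, rfl, heq.trans hinv.2⟩

end Greedy

/-! ## Reasoning about programs -/

section Machine

variable {R T : Type}

@[simp] theorem State.setReg_reg [DecidableEq R] (s : State R T) (r r' : R) (x : ℕ) :
    (s.setReg r x).reg r' = if r' = r then x else s.reg r' := by
  simp [State.setReg, Function.update_apply]

@[simp] theorem State.setReg_tab [DecidableEq R] (s : State R T) (r : R) (x : ℕ) :
    (s.setReg r x).tab = s.tab :=
  rfl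

@[simp] theorem State.setCell_reg [DecidableEq T] (s : State R T) (t : T) (i j x : ℕ) :
    (s.setCell t i j x).reg = s.reg :=
  rfl

@[simp] theorem State.setCell_tab [DecidableEq T] (s : State R T) (t t' : T) (i j x i' j' : ℕ) :
    (s.setCell t i j x).tab t' i' j' =
      if t' = t ∧ i' = i ∧ j' = j then x else s.tab t' i' j' := by
  rcases eq_or_ne t' t with rfl | ht
  · rcases eq_or_ne i' i with rfl | hi <;> simp [State.setCell, Function.update_apply, *]
  · simp [State.setCell, ht]

@[simp] theorem BExpr.eval_lt_iff {s : State R T} {a b : Expr R T} :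
    (BExpr.lt a b).eval s = true ↔ a.eval s < b.eval s := by
  simp [BExpr.eval]

@[simp] theorem BExpr.eval_eq_iff {s : State R T} {a b : Expr R T} :
    (BExpr.eq a b).eval s = true ↔ a.eval s = b.eval s := by
  simp [BExpr.eval]

@[simp] theorem BExpr.eval_not_iff {s : State R T} {b : BExpr R T} :
    b.not.eval s = true ↔ ¬ b.eval s = true := by
  simp [BExpr.eval]

@[simp] theorem BExpr.eval_or_iff {s : State R T} {b c : BExpr R T} :
    (b.or c).eval s = true ↔ b.eval s = true ∨ c.eval s = true := by
  simp [BExpr.eval]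

@[simp] theorem BExpr.eval_and_iff {s : State R T} {b c : BExpr R T} :
    (b.and c).eval s = true ↔ b.eval s = true ∧ c.eval s = true := by
  simp [BExpr.eval]

variable [DecidableEq R] [DecidableEq T]

/-- Some assignment in the command has the register `r` as its target. -/
def Cmd.writesReg (r : R) : Cmd R T → Bool
  | .skip => false
  | .set r' _ => decide (r' = r)
  | .store _ _ _ _ => false
  | .seq c d => c.writesReg r || d.writesReg r
  | .ite _ c d => c.writesReg r || d.writesReg r
  | .while _ c => c.writesReg r

/-- Some assignment in the command has an entry of the table `t` as its target. -/
def Cmd.writesTab (t : T) : Cmd R T → Bool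
  | .skip => false
  | .set _ _ => false
  | .store t' _ _ _ => decide (t' = t)
  | .seq c d => c.writesTab t || d.writesTab t
  | .ite _ c d => c.writesTab t || d.writesTab t
  | .while _ c => c.writesTab t

/-- The states `s` and `s'` agree on all registers and tables that `c` does not write. Every
execution of `c` from `s` to `s'` has this property, and so have the intermediate states. -/
def SameOutside (c : Cmd R T) (s s' : State R T) : Prop :=
  (∀ r, c.writesReg r = false → s'.reg r = s.reg r) ∧
    ∀ t, c.writesTab t = false → s'.tab t = s.tab t

namespace SameOutside

variable {c d : Cmd R T} {s s' s'' : State R T}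

theorem refl (c : Cmd R T) (s : State R T) : SameOutside c s s :=
  ⟨fun _ _ => rfl, fun _ _ => rfl⟩

theorem trans (h : SameOutside c s s') (h' : SameOutside c s' s'') : SameOutside c s s'' :=
  ⟨fun r hr => (h'.1 r hr).trans (h.1 r hr), fun t ht => (h'.2 t ht).trans (h.2 t ht)⟩

theorem seq_left (h : SameOutside c s s') : SameOutside (c ;; d) s s' :=
  ⟨fun r hr => h.1 r (Bool.or_eq_false_iff.1 hr).1, fun t ht => h.2 t (Bool.or_eq_false_iff.1 ht).1⟩

theorem seq_right (h : SameOutside d s s') : SameOutside (c ;; d) s s' :=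
  ⟨fun r hr => h.1 r (Bool.or_eq_false_iff.1 hr).2, fun t ht => h.2 t (Bool.or_eq_false_iff.1 ht).2⟩

theorem seq (h : SameOutside c s s') (h' : SameOutside d s' s'') : SameOutside (c ;; d) s s'' :=
  h.seq_left.trans h'.seq_right

theorem setReg (s : State R T) (r : R) (e : Expr R T) (x : ℕ) :
    SameOutside (.set r e) s (s.setReg r x) := by
  refine ⟨fun r' hr => ?_, fun _ _ => rfl⟩
  simp [Ne.symm (of_decide_eq_false hr)]

theorem setCell (s : State R T) (t : T) (i j e : Expr R T) (x y z : ℕ) :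
    SameOutside (.store t i j e) s (s.setCell t x y z) := by
  refine ⟨fun _ _ => rfl, fun t' ht => ?_⟩
  funext i' j'
  simp [Ne.symm (of_decide_eq_false ht)]

end SameOutside

theorem Exec.sameOutside {c : Cmd R T} {s s' : State R T} {t : ℕ} (h : Exec c s s' t) :
    SameOutside c s s' := by
  induction h with
  | skip s => exact .refl _ _
  | set s r e => exact .setReg s r e _
  | store s t i j e => exact .setCell s t i j e _ _ _
  | seq _ _ ihc ihd => exact ihc.seq ihd
  | ite_true _ _ ih => exact ih.seq_left
  | ite_false _ _ ih => exact ih.seq_right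
  | while_true _ _ _ ihbody ihrest => exact SameOutside.trans ihbody ihrest
  | while_false _ => exact .refl _ _

/-- The command `c`, started in `s`, terminates in a state and after a time that satisfy `Q`. -/
def Runs (c : Cmd R T) (s : State R T) (Q : State R T → ℕ → Prop) : Prop :=
  ∃ s' t, Exec c s s' t ∧ Q s' t

theorem Runs.mono {c : Cmd R T} {s : State R T} {Q Q' : State R T → ℕ → Prop} (h : Runs c s Q)
    (hQ : ∀ s' t, SameOutside c s s' → Q s' t → Q' s' t) : Runs c s Q' := by
  obtain ⟨s', t, hexec, hq⟩ := h
  exact ⟨s', t, hexec, hQ s' t hexec.sameOutside hq⟩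

theorem Runs.seq {c d : Cmd R T} {s : State R T} {Q Q' : State R T → ℕ → Prop} (h : Runs c s Q)
    (h' : ∀ s' t, SameOutside c s s' → Q s' t → Runs d s' fun s'' t' => Q' s'' (t + t')) :
    Runs (c ;; d) s Q' := by
  obtain ⟨s', t, hexec, hq⟩ := h
  obtain ⟨s'', t', hexec', hq'⟩ := h' s' t hexec.sameOutside hq
  exact ⟨s'', t + t', .seq hexec hexec', hq'⟩

theorem runs_ite {b : BExpr R T} {c d : Cmd R T} {s : State R T} {Q : State R T → ℕ → Prop}
    (h : b.eval s = true → Runs c s fun s' t => Q s' (b.cost + 1 + t))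
    (h' : ¬ b.eval s = true → Runs d s fun s' t => Q s' (b.cost + 1 + t)) :
    Runs (.ite b c d) s Q := by
  by_cases hb : b.eval s = true
  · obtain ⟨s', t, hexec, hq⟩ := h hb
    exact ⟨s', _, .ite_true hb hexec, hq⟩
  · obtain ⟨s', t, hexec, hq⟩ := h' hb
    exact ⟨s', _, .ite_false (Bool.eq_false_of_not_eq_true hb) hexec, hq⟩

/-- A command without loops. -/
def Cmd.loopFree : Cmd R T → Bool
  | .skip => true
  | .set _ _ => true
  | .store _ _ _ _ => true
  | .seq c d => c.loopFree && d.loopFree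
  | .ite _ c d => c.loopFree && d.loopFree
  | .while _ _ => false

/-- A bound for the running time of a loop-free command; both branches of a conditional are
counted. The value at a loop is a junk value. -/
def Cmd.size : Cmd R T → ℕ
  | .skip => 1
  | .set _ e => e.cost + 1
  | .store _ i j e => i.cost + j.cost + e.cost + 1
  | .seq c d => c.size + d.size
  | .ite b c d => b.cost + 1 + (c.size + d.size)
  | .while _ _ => 0

/-- The effect of a loop-free command. The value at a loop is a junk value. -/
def Cmd.apply : Cmd R T → State R T → State R T
  | .skip, s => s
  | .set r e, s => s.setReg r (e.eval s)
  | .store t i j e, s => s.setCell t (i.eval s) (j.eval s) (e.eval s)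
  | .seq c d, s => d.apply (c.apply s)
  | .ite b c d, s => if b.eval s = true then c.apply s else d.apply s
  | .while _ _, s => s

theorem exec_apply {c : Cmd R T} (hc : c.loopFree = true) (s : State R T) :
    ∃ t ≤ c.size, Exec c s (c.apply s) t := by
  induction c generalizing s with
  | skip => exact ⟨_, le_rfl, .skip s⟩
  | set r e => exact ⟨_, le_rfl, .set s r e⟩
  | store t i j e => exact ⟨_, le_rfl, .store s t i j e⟩
  | seq c d ihc ihd =>
    obtain ⟨hc, hd⟩ := Bool.and_eq_true_iff.1 hc
    obtain ⟨t, ht, hexec⟩ := ihc hc s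
    obtain ⟨t', ht', hexec'⟩ := ihd hd (c.apply s)
    exact ⟨t + t', Nat.add_le_add ht ht', .seq hexec hexec'⟩
  | ite b c d ihc ihd =>
    obtain ⟨hc, hd⟩ := Bool.and_eq_true_iff.1 hc
    unfold Cmd.apply Cmd.size
    split_ifs with hb
    · obtain ⟨t, ht, hexec⟩ := ihc hc s
      exact ⟨b.cost + 1 + t, by omega, .ite_true hb hexec⟩
    · obtain ⟨t, ht, hexec⟩ := ihd hd s
      exact ⟨b.cost + 1 + t, by omega, .ite_false (Bool.eq_false_of_not_eq_true hb) hexec⟩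
  | _ => cases hc

theorem sameOutside_apply {c : Cmd R T} (hc : c.loopFree = true) (s : State R T) :
    SameOutside c s (c.apply s) :=
  (exec_apply hc s).elim fun _ h => h.2.sameOutside

theorem runs_of_loopFree {c : Cmd R T} (hc : c.loopFree = true) {s : State R T}
    {Q : State R T → ℕ → Prop} (h : ∀ t ≤ c.size, Q (c.apply s) t) : Runs c s Q := by
  obtain ⟨t, ht, hexec⟩ := exec_apply hc s
  exact ⟨_, t, hexec, h t ht⟩

theorem Runs.seq_of_loopFree {c d : Cmd R T} (hc : c.loopFree = true) {s : State R T}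
    {Q : State R T → ℕ → Prop}
    (h : ∀ t ≤ c.size, SameOutside c s (c.apply s) →
      Runs d (c.apply s) fun s' t' => Q s' (t + t')) : Runs (c ;; d) s Q :=
  Runs.seq (runs_of_loopFree hc (Q := fun s' t => s' = c.apply s ∧ t ≤ c.size)
    fun _ ht => ⟨rfl, ht⟩) (by rintro _ t hs ⟨rfl, ht⟩; exact h t ht hs)

/-- Amortized analysis of a loop: the drop of the potential `Φ` pays for the body and the test. As
the test has a positive cost, the loop terminates. -/
theorem runs_while {b : BExpr R T} {c : Cmd R T} (I : State R T → Prop) (Φ : State R T → ℕ)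
    {s : State R T} (h0 : I s)
    (hstep : ∀ s', SameOutside c s s' → I s' → b.eval s' = true →
      Runs c s' fun s'' t => I s'' ∧ b.cost + 1 + t + Φ s'' ≤ Φ s') :
    Runs (.while b c) s fun s' t =>
      I s' ∧ ¬ b.eval s' = true ∧ t + Φ s' ≤ Φ s + (b.cost + 1) := by
  suffices h : ∀ k s', SameOutside c s s' → I s' → Φ s' = k →
      Runs (.while b c) s' fun s'' t =>
        I s'' ∧ ¬ b.eval s'' = true ∧ t + Φ s'' ≤ Φ s' + (b.cost + 1) from
    h _ s (.refl _ _) h0 rfl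
  intro k
  induction k using Nat.strong_induction_on with
  | _ k ih =>
    rintro s' hs' hI rfl
    by_cases hb : b.eval s' = true
    · obtain ⟨s₁, t₁, hexec₁, hI₁, hΦ₁⟩ := hstep s' hs' hI hb
      obtain ⟨s₂, t₂, hexec₂, hI₂, hb₂, hΦ₂⟩ :=
        ih (Φ s₁) (by omega) s₁ (hs'.trans hexec₁.sameOutside) hI₁ rfl
      exact ⟨s₂, _, .while_true hb hexec₁ hexec₂, hI₂, hb₂, by omega⟩
    · exact ⟨s', _, .while_false (Bool.eq_false_of_not_eq_true hb), hI, hb, by omega⟩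

theorem runs_for_amortized {r N : R} {c : Cmd R T} (hrN : N ≠ r) (hr : c.writesReg r = false)
    (hN : c.writesReg N = false) (I : ℕ → State R T → Prop) (Φ : State R T → ℕ) (B : ℕ)
    {s : State R T} (h0 : I 0 (s.setReg r 0))
    (hstep : ∀ k s', k < s.reg N → SameOutside (Cmd.for r (.reg N) c) s s' → s'.reg r = k →
      I k s' → Runs c s' fun s'' t =>
        I (k + 1) (s''.setReg r (k + 1)) ∧ t + Φ (s''.setReg r (k + 1)) ≤ Φ s' + B) :
    Runs (Cmd.for r (.reg N) c) s fun s' t =>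
      I (s.reg N) s' ∧ t + Φ s' ≤ Φ (s.setReg r 0) + (B + 7) * s.reg N + 6 := by
  refine Runs.seq_of_loopFree rfl fun t₀ (ht₀ : t₀ ≤ 2) hs₀ => ?_
  change Runs _ (s.setReg r 0) _
  refine (runs_while (fun s' => s'.reg N = s.reg N ∧ s'.reg r ≤ s.reg N ∧ I (s'.reg r) s')
    (fun s' => Φ s' + (B + 7) * (s.reg N - s'.reg r)) (by simpa [hrN] using h0) ?_).mono ?_
  · rintro s' hs' ⟨hNs, -, hI⟩ hlt
    replace hlt : s'.reg r < s.reg N := by simpa [Expr.eval, hNs] using hlt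
    refine Runs.seq (hstep _ s' hlt (hs₀.seq hs') rfl hI) ?_
    rintro s₁ t₁ hs₁ ⟨hI₁, hΦ₁⟩
    have hincr : (Cmd.set r (.succ (.reg r))).apply s₁ = s₁.setReg r (s'.reg r + 1) := by
      simp [Cmd.apply, Expr.eval, hs₁.1 r hr]
    refine runs_of_loopFree rfl fun t₂ (ht₂ : t₂ ≤ 3) => ?_
    rw [hincr]
    refine ⟨⟨by simp [hrN, hs₁.1 N hN, hNs], by simpa using hlt, by simpa using hI₁⟩, ?_⟩
    have hrest : s.reg N - s'.reg r = s.reg N - (s'.reg r + 1) + 1 := by omega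
    simp only [State.setReg_reg, if_true, BExpr.cost, Expr.cost, hrest, Nat.mul_add]
    omega
  · rintro s' t - ⟨⟨hNs, hle, hI⟩, hge, ht⟩
    have heq : s'.reg r = s.reg N := hle.antisymm (by simpa [Expr.eval, hNs] using hge)
    simp only [heq, State.setReg_reg, if_true, BExpr.cost, Expr.cost, Nat.sub_zero, Nat.sub_self,
      Nat.mul_zero] at hI ht
    exact ⟨hI, by omega⟩

theorem runs_for {r N : R} {c : Cmd R T} (hrN : N ≠ r) (hr : c.writesReg r = false)
    (hN : c.writesReg N = false) (I : ℕ → State R T → Prop) (B : ℕ) {s : State R T}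
    (h0 : I 0 (s.setReg r 0))
    (hstep : ∀ k s', k < s.reg N → SameOutside (Cmd.for r (.reg N) c) s s' → s'.reg r = k →
      I k s' → Runs c s' fun s'' t => I (k + 1) (s''.setReg r (k + 1)) ∧ t ≤ B) :
    Runs (Cmd.for r (.reg N) c) s fun s' t => I (s.reg N) s' ∧ t ≤ (B + 7) * s.reg N + 6 := by
  refine (runs_for_amortized hrN hr hN I (fun _ => 0) B h0 ?_).mono (by simp)
  simpa using hstep

theorem runs_fill {r N : R} (hrN : N ≠ r) (tb : T) (e : Expr R T) (f : ℕ → ℕ) {s : State R T}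
    (he : ∀ k s', k < s.reg N →
      SameOutside (Cmd.for r (.reg N) (.store tb (.const 0) (.reg r) e)) s s' →
      s'.reg r = k → e.eval s' = f k) :
    Runs (Cmd.for r (.reg N) (.store tb (.const 0) (.reg r) e)) s fun s' t =>
      (∀ k < s.reg N, s'.tab tb 0 k = f k) ∧ t ≤ (e.cost + 10) * s.reg N + 6 := by
  refine (runs_for hrN rfl rfl (fun k s' => ∀ j < k, s'.tab tb 0 j = f j) (e.cost + 3)
    (by simp) fun k s' hk hs' hr hI => ?_)
  refine runs_of_loopFree rfl fun t ht => ⟨fun j hj => ?_, ht.trans ?_⟩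
  · by_cases hjk : j = k
    · simp [Cmd.apply, hjk, hr, Expr.eval, he k s' hk hs' hr]
    · simpa [Cmd.apply, hjk, hr, Expr.eval] using hI j (by omega)
  · simp only [Cmd.size, Expr.cost]
    omega

end Machine

/-! ## Deferred acceptance with one proposal at a time -/

theorem PrefList.idxOf_lt {n : ℕ} (l : PrefList n) (a : Fin n) : l.toList.idxOf a < n := by
  simpa [l.length_eq] using List.idxOf_lt_length_iff.2 (l.mem a)

theorem PrefList.exists_getElem? {n : ℕ} (l : PrefList n) {j : ℕ} (hj : j < n) :
    ∃ w, l.toList[j]? = some w ∧ l.toList.idxOf w = j := by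
  have hj' : j < l.toList.length := by rwa [l.length_eq]
  exact ⟨l.toList[j], by simp, l.nodup.idxOf_getElem j hj'⟩

theorem prefers_da_of_woman_prefers {n : ℕ} {P : Profile n} {w c b : Fin n}
    (hc : (P.men c).WeaklyPrefers w (da P c)) (hb : (P.men b).WeaklyPrefers w (da P b))
    (hp : (P.women w).Prefers c b) : (P.men b).Prefers w (da P b) := by
  refine hb.prefers_of_ne fun hwb => ?_
  rcases hc with hlt | hwc
  · have hrebuff := da_isStable P c w hlt
    rw [Rebuffs, hwb, Equiv.symm_apply_apply, ← hwb, ← PrefList.not_prefers] at hrebuff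
    exact hrebuff hp
  · exact hp.ne ((da P).injective (hwc.symm.trans hwb))

/-- The situation when the men below `i` have entered: `nx` counts the proposals made by each man,
`hb` gives the engagements, and `cur` is the free man among those who have entered. -/
structure SeqInv {n : ℕ} (P : Profile n) (i : ℕ) (nx : Fin n → ℕ) (hb : Fin n → Option (Fin n))
    (cur : Option (Fin n)) : Prop where
  outside : ∀ j : Fin n, i ≤ j → nx j = 0
  held : ∀ w j, hb w = some j → (P.men j).toList.idxOf w + 1 = nx j
  better : ∀ j w, (P.men j).toList.idxOf w < nx j →
    ∃ b, hb w = some b ∧ (P.women w).WeaklyPrefers b j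
  engaged : ∀ j : Fin n, j < i → cur ≠ some j → ∃ w, hb w = some j
  bound : ∀ w j, hb w = some j → (P.men j).WeaklyPrefers w (da P j)
  free : ∀ c : Fin n, cur = some c →
    c < i ∧ nx c ≤ (P.men c).toList.idxOf (da P c) ∧ ∀ w, hb w ≠ some c

namespace SeqInv

variable {n : ℕ} {P : Profile n} {i : ℕ} {nx : Fin n → ℕ} {hb : Fin n → Option (Fin n)}
  {c w b : Fin n}

theorem init (P : Profile n) : SeqInv P 0 (fun _ => 0) (fun _ => none) none where
  outside _ _ := rfl
  held _ _ h := by cases h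
  better _ _ h := absurd h (Nat.not_lt_zero _)
  engaged _ h := absurd h (Nat.not_lt_zero _)
  bound _ _ h := by cases h
  free _ h := by cases h

theorem enter {j : Fin n} (h : SeqInv P j nx hb none) : SeqInv P (j + 1) nx hb (some j) where
  outside j' hj' := h.outside j' (by omega)
  held := h.held
  better := h.better
  engaged j' hj' hne := by
    have hjj' : (j : ℕ) ≠ j' := fun h' => hne (by rw [Fin.ext h'])
    exact h.engaged j' (by omega) (by simp)
  bound := h.bound
  free c hc := by
    cases hc
    have h0 := h.outside j le_rfl
    refine ⟨by omega, by omega, fun w hw => ?_⟩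
    have := h.held w j hw
    omega

theorem sum_lt (h : SeqInv P i nx hb (some c)) : ∑ j, nx j < n * n := by
  have hlt : ∑ j, nx j < ∑ _j : Fin n, n := by
    refine Finset.sum_lt_sum (fun j _ => ?_)
      ⟨c, Finset.mem_univ c, (h.free c rfl).2.1.trans_lt ((P.men c).idxOf_lt _)⟩
    by_contra! hj
    obtain ⟨w, hw⟩ := h.engaged j (by by_contra! hij; have := h.outside j hij; omega) (by
      rintro ⟨rfl⟩
      have := (h.free c rfl).2.1.trans_lt ((P.men c).idxOf_lt _)
      omega)
    have := h.held w j hw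
    have := (P.men j).idxOf_lt w
    omega
  simpa using hlt

theorem weaklyPrefers_da (h : SeqInv P i nx hb (some c)) (hw : (P.men c).toList.idxOf w = nx c) :
    (P.men c).WeaklyPrefers w (da P c) :=
  PrefList.weaklyPrefers_iff_le.2 (hw.le.trans (h.free c rfl).2.1)

theorem outside_propose (h : SeqInv P i nx hb (some c)) (j : Fin n) (hj : i ≤ j) :
    Function.update nx c (nx c + 1) j = 0 := by
  have hci := (h.free c rfl).1
  rw [Function.update_of_ne (by rintro rfl; omega)]
  exact h.outside j hj

theorem held_propose (h : SeqInv P i nx hb (some c)) {w j : Fin n} (hj : hb w = some j) :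
    (P.men j).toList.idxOf w + 1 = Function.update nx c (nx c + 1) j := by
  rw [Function.update_of_ne (by rintro rfl; exact (h.free j rfl).2.2 w hj)]
  exact h.held w j hj

theorem lt_or_eq_of_lt_propose (hw : (P.men c).toList.idxOf w = nx c) {j w' : Fin n}
    (hj : (P.men j).toList.idxOf w' < Function.update nx c (nx c + 1) j) :
    (P.men j).toList.idxOf w' < nx j ∨ j = c ∧ w' = w := by
  rcases eq_or_ne j c with rfl | hjc
  · rw [Function.update_self, Nat.lt_succ_iff_lt_or_eq] at hj
    exact hj.imp_right fun heq => ⟨rfl, (P.men j).idxOf_inj (heq.trans hw.symm)⟩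
  · left
    rwa [Function.update_of_ne hjc] at hj

theorem free_displaced (h : SeqInv P i nx hb (some c)) (hw : (P.men c).toList.idxOf w = nx c)
    (hwb : hb w = some b) (hp : (P.women w).Prefers c b) :
    b < i ∧ Function.update nx c (nx c + 1) b ≤ (P.men b).toList.idxOf (da P b) ∧
      ∀ w', Function.update hb w (some c) w' ≠ some b := by
  have hheld := h.held w b hwb
  refine ⟨?_, ?_, fun w' hw' => ?_⟩
  · by_contra! hib
    have := h.outside b hib
    omega
  · rw [Function.update_of_ne hp.ne.symm, ← hheld]
    exact prefers_da_of_woman_prefers (h.weaklyPrefers_da hw) (h.bound w b hwb) hp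
  · rcases eq_or_ne w' w with rfl | hww
    · rw [Function.update_self] at hw'
      exact hp.ne (Option.some.inj hw')
    · rw [Function.update_of_ne hww] at hw'
      have := h.held w' b hw'
      exact hww ((P.men b).idxOf_inj (by omega))

theorem accept (h : SeqInv P i nx hb (some c)) (hw : (P.men c).toList.idxOf w = nx c)
    (hp : ∀ b, hb w = some b → (P.women w).Prefers c b) :
    SeqInv P i (Function.update nx c (nx c + 1)) (Function.update hb w (some c)) (hb w) where
  outside := h.outside_propose
  held w' j hj := by
    rcases eq_or_ne w' w with rfl | hww
    · obtain rfl : c = j := by simpa using hj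
      rw [Function.update_self, hw]
    · rw [Function.update_of_ne hww] at hj
      exact h.held_propose hj
  better j w' hj := by
    rcases lt_or_eq_of_lt_propose hw hj with hlt | ⟨rfl, rfl⟩
    · obtain ⟨b, hwb, hbj⟩ := h.better j w' hlt
      rcases eq_or_ne w' w with rfl | hww
      · exact ⟨c, Function.update_self .., .trans (.inl (hp b hwb)) hbj⟩
      · exact ⟨b, by rwa [Function.update_of_ne hww], hbj⟩
    · exact ⟨j, Function.update_self .., .inr rfl⟩
  engaged j hj hne := by
    rcases eq_or_ne j c with rfl | hjc
    · exact ⟨w, Function.update_self ..⟩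
    · obtain ⟨w', hw'⟩ := h.engaged j hj (by simpa using hjc.symm)
      exact ⟨w', by rwa [Function.update_of_ne (by rintro rfl; exact hne hw')]⟩
  bound w' j hj := by
    rcases eq_or_ne w' w with rfl | hww
    · obtain rfl : c = j := by simpa using hj
      exact h.weaklyPrefers_da hw
    · rw [Function.update_of_ne hww] at hj
      exact h.bound w' j hj
  free b hwb := h.free_displaced hw hwb (hp b hwb)

theorem reject (h : SeqInv P i nx hb (some c)) (hw : (P.men c).toList.idxOf w = nx c)
    (hwb : hb w = some b) (hp : (P.women w).Prefers b c) :
    SeqInv P i (Function.update nx c (nx c + 1)) hb (some c) where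
  outside := h.outside_propose
  held _ _ := h.held_propose
  better j w' hj := by
    rcases lt_or_eq_of_lt_propose hw hj with hlt | ⟨rfl, rfl⟩
    · exact h.better j w' hlt
    · exact ⟨b, hwb, .inl hp⟩
  engaged := h.engaged
  bound := h.bound
  free j hj := by
    obtain rfl : c = j := by simpa using hj
    obtain ⟨hci, -, hcw⟩ := h.free c rfl
    refine ⟨hci, ?_, hcw⟩
    rw [Function.update_self, ← hw]
    exact prefers_da_of_woman_prefers (h.bound w b hwb) (h.weaklyPrefers_da hw) hp

theorem eq_da (h : SeqInv P n nx hb none) (w : Fin n) : hb w = some ((da P).symm w) := by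
  obtain ⟨j, rfl⟩ := (da P).surjective w
  obtain ⟨w, hw⟩ := h.engaged j j.2 (by simp)
  have hheld := h.held w j hw
  suffices hle : daState P j ≤ nx j - 1 by
    rw [← idxOf_da] at hle
    rw [Equiv.symm_apply_apply,
      (PrefList.weaklyPrefers_iff_le.2 (by omega : _ ≤ _)).antisymm (h.bound w j hw), hw]
  -- every man stops at his fiancee, who has rejected all the others that have reached her
  refine daState_le_of_closed (K := fun j => nx j - 1) (fun j w hjw j' hj' => ?_) j
  obtain ⟨v, hv⟩ := h.engaged j j.2 (by simp)
  obtain ⟨v', hv'⟩ := h.engaged j' j'.2 (by simp)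
  have hheld := h.held v j hv
  have hheld' := h.held v' j' hv'
  obtain rfl : w = v := (P.men j).idxOf_inj (by omega)
  obtain ⟨b, hwb, hbj'⟩ := h.better j' w (by omega)
  obtain rfl : j = b := Option.some.inj (hv.symm.trans hwb)
  exact hbj'

end SeqInv

/-! ## The program for deferred acceptance -/

section Encodings

variable {n : ℕ}

/-- The row `f` of a table begins with the list `L`; the entries after the end of `L` are
arbitrary. -/
def EncodesList (f : ℕ → ℕ) (L : List (Fin n)) : Prop :=
  ∀ (k : ℕ) (w : Fin n), L[k]? = some w → f k = w

/-- The row `f` of a table lists the partners of the women in the matching `μ`. -/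
def EncodesMatching (f : ℕ → ℕ) (μ : Fin n ≃ Fin n) : Prop :=
  ∀ w : Fin n, f w = μ.symm w

/-- The row `f` of a table is the indicator function of the set `X`. -/
def EncodesSet (f : ℕ → ℕ) (X : Finset (Fin n)) : Prop :=
  ∀ w : Fin n, f w = if w ∈ X then 1 else 0

theorem encodesList_encodeLists (f : Fin n → PrefList n) (i : Fin n) :
    EncodesList (encodeLists f i) (f i).toList :=
  fun _ _ h => by simp [encodeLists, h]

end Encodings

/-- The input and the precomputed positions are in place. -/
structure Ready {n : ℕ} (P : Profile n) (m : Fin n) (s : State Reg Tab) : Prop where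
  n_eq : s.reg .n = n
  acc_eq : s.reg .acc = m
  mp_eq : s.tab .mp = encodeLists P.men
  rank_eq : ∀ w j : Fin n, s.tab .rank w j = (P.women w).toList.idxOf j
  mrank_eq : ∀ w : Fin n, s.tab .mrank 0 w = (P.men m).toList.idxOf w

theorem Ready.of_sameOutside {n : ℕ} {P : Profile n} {m : Fin n} {s s' : State Reg Tab}
    {c : Cmd Reg Tab} (h : Ready P m s) (hs : SameOutside c s s')
    (hc : (c.writesReg .n || c.writesReg .acc || c.writesTab .mp || c.writesTab .rank ||
      c.writesTab .mrank) = false) : Ready P m s' := by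
  simp only [Bool.or_eq_false_iff] at hc
  obtain ⟨⟨⟨⟨hn, hacc⟩, hmp⟩, hrank⟩, hmrank⟩ := hc
  refine ⟨?_, ?_, ?_, ?_, ?_⟩
  · rw [hs.1 _ hn, h.n_eq]
  · rw [hs.1 _ hacc, h.acc_eq]
  · rw [hs.2 _ hmp, h.mp_eq]
  · rw [hs.2 _ hrank]
    exact h.rank_eq
  · rw [hs.2 _ hmrank]
    exact h.mrank_eq

namespace Program

/-- Part of `runDA`: the next woman on the list of the man `cur` is stored in the register `w`. -/
def chooseWoman : Cmd Reg Tab :=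
  .ite (.eq (v .cur) (v .acc))
    (.set .w (at1 .strat (at1 .next (v .cur))))
    (.set .w (.cell .mp (v .cur) (at1 .next (v .cur))))

/-- Part of `runDA`: the woman `w`, engaged to `h`, answers the proposal of the man `cur`. -/
def respond : Cmd Reg Tab :=
  .ite (.eq (v .h) (v .n))
    (put1 .husb (v .w) (v .cur) ;; .set .active (.const 0))
    (.ite (.lt (.cell .rank (v .w) (v .cur)) (.cell .rank (v .w) (v .h)))
      (put1 .husb (v .w) (v .cur) ;; .set .cur (v .h))
      .skip)

/-- The body of the inner loop of `runDA`: one proposal. -/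
def proposeStep : Cmd Reg Tab :=
  chooseWoman ;; put1 .next (v .cur) (.succ (at1 .next (v .cur))) ;;
    .set .h (at1 .husb (v .w)) ;; respond

/-- The body of the outer loop of `runDA`: the man `i` enters. -/
def enterStep : Cmd Reg Tab :=
  .set .cur (v .i) ;; .set .active (.const 1) ;; .while (.eq (v .active) (.const 1)) proposeStep

theorem runDA_eq : runDA =
    (.for .i (v .n) (put1 .next (v .i) (.const 0) ;; put1 .husb (v .i) (v .n)) ;;
      .for .i (v .n) enterStep) :=
  rfl

section RunDA

variable {n : ℕ} {P : Profile n} {m : Fin n} {l : PrefList n} {s : State Reg Tab} {i : ℕ}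
  {nx : Fin n → ℕ} {hb : Fin n → Option (Fin n)} {c w : Fin n}

/-- The tables `next` and `husb` represent the numbers of proposals `nx` and the engagements `hb`;
a woman without a fiance has the entry `n`. -/
def Represents (s : State Reg Tab) (nx : Fin n → ℕ) (hb : Fin n → Option (Fin n)) : Prop :=
  (∀ j : Fin n, s.tab .next 0 j = nx j) ∧
    ∀ w : Fin n, s.tab .husb 0 w = (hb w).elim n (fun j => (j : ℕ))

theorem Represents.setCell_next (h : Represents s nx hb) (c : Fin n) (k : ℕ) :
    Represents (s.setCell .next 0 c k) (Function.update nx c k) hb :=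
  ⟨fun j => by simp [Function.update_apply, h.1, Fin.val_inj], h.2⟩

theorem Represents.setCell_husb (h : Represents s nx hb) (w c : Fin n) :
    Represents (s.setCell .husb 0 w c) nx (Function.update hb w (some c)) := by
  refine ⟨h.1, fun w' => ?_⟩
  by_cases hww : w' = w <;> simp [h.2, Fin.val_inj, hww]

/-- The invariant of the inner loop of `runDA`: the man `cur` is free if `active` is `1`, and no
man is free if `active` is `0`. -/
def ProposeInv (Q : Profile n) (i : ℕ) (s : State Reg Tab) : Prop :=
  ∃ nx hb cur, SeqInv Q i nx hb cur ∧ Represents s nx hb ∧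
    ((cur = none ∧ s.reg .active = 0) ∨ ∃ c, cur = some c ∧ s.reg .active = 1 ∧ s.reg .cur = c)

theorem chooseWoman_apply (hs : Ready P m s)
    (hl : EncodesList (s.tab .strat 0) l.toList) (hc : s.reg .cur = c)
    (hw : ((misreport P m l).men c).toList[s.tab .next 0 c]? = some w) :
    chooseWoman.apply s = s.setReg .w w := by
  by_cases hcm : c = m
  · simp only [misreport, hcm, Function.update_self] at hw
    simp [chooseWoman, Cmd.apply, Expr.eval, hc, hcm, hs.acc_eq, hl _ w hw]
  · simp only [misreport, Function.update_of_ne hcm] at hw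
    have hval : ¬ (c : ℕ) = m := fun h => hcm (Fin.ext h)
    simp [chooseWoman, Cmd.apply, Expr.eval, hc, hval, hs.acc_eq, hs.mp_eq,
      encodesList_encodeLists P.men c _ w hw]

theorem proposeInv_respond (hs : Ready P m s) (hinv : SeqInv (misreport P m l) i nx hb (some c))
    (hidx : ((misreport P m l).men c).toList.idxOf w = nx c)
    (hrep : Represents s (Function.update nx c (nx c + 1)) hb) (hc : s.reg .cur = c)
    (hw : s.reg .w = w) (hh : s.reg .h = s.tab .husb 0 w) (hactive : s.reg .active = 1) :
    ProposeInv (misreport P m l) i (respond.apply s) := by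
  rw [hrep.2] at hh
  cases hwb : hb w with
  | none =>
    have happly : respond.apply s = (s.setCell .husb 0 w c).setReg .active 0 := by
      simp [respond, Cmd.apply, Expr.eval, hs.n_eq, hc, hw, hh, hwb]
    rw [happly]
    exact ⟨_, _, _, hinv.accept hidx (by simp [hwb]), hrep.setCell_husb w c,
      .inl ⟨hwb, by simp⟩⟩
  | some b =>
    have hbn : (b : ℕ) ≠ n := b.2.ne
    by_cases hp : (P.women w).Prefers c b
    · have hrank : s.tab .rank w c < s.tab .rank w b := by
        rwa [hs.rank_eq, hs.rank_eq]
      have happly : respond.apply s = (s.setCell .husb 0 w c).setReg .cur b := by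
        simp [respond, Cmd.apply, Expr.eval, hs.n_eq, hc, hw, hh, hwb, hbn, hrank]
      rw [happly]
      refine ⟨_, _, _, hinv.accept hidx fun b' hb' => ?_, hrep.setCell_husb w c,
        .inr ⟨b, hwb, by simpa using hactive, by simp⟩⟩
      rw [hwb] at hb'
      exact Option.some.inj hb' ▸ hp
    · have hrank : ¬ s.tab .rank w c < s.tab .rank w b := by
        rwa [hs.rank_eq, hs.rank_eq]
      have happly : respond.apply s = s := by
        simp [respond, Cmd.apply, Expr.eval, hs.n_eq, hc, hw, hh, hwb, hbn, hrank]
      have hcb : b ≠ c := by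
        rintro rfl
        exact (hinv.free b rfl).2.2 w hwb
      rw [happly]
      exact ⟨_, _, _, hinv.reject hidx hwb ((PrefList.not_prefers.1 hp).prefers_of_ne hcb), hrep,
        .inr ⟨c, rfl, hactive, hc⟩⟩

/-- The number of proposals that can still be made. -/
def remainingProposals (n : ℕ) (s : State Reg Tab) : ℕ :=
  n * n - ∑ j : Fin n, s.tab .next 0 j

theorem remainingProposals_lt {s' : State Reg Tab} (hinv : SeqInv P i nx hb (some c))
    (hrep : Represents s nx hb)
    (hrep' : ∀ j : Fin n, s'.tab .next 0 j = Function.update nx c (nx c + 1) j) :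
    remainingProposals n s' < remainingProposals n s := by
  have hsum : ∑ j, Function.update nx c (nx c + 1) j = ∑ j, nx j + 1 := by
    rw [Finset.sum_update_of_mem (Finset.mem_univ c), ← Finset.erase_eq,
      ← Finset.add_sum_erase Finset.univ nx (Finset.mem_univ c)]
    omega
  have hlt := hinv.sum_lt
  simp only [remainingProposals, hrep.1, hrep']
  omega

theorem runs_proposeStep (hs : Ready P m s) (hl : EncodesList (s.tab .strat 0) l.toList)
    (hI : ProposeInv (misreport P m l) i s) (hactive : s.reg .active = 1) :
    Runs proposeStep s fun s' t => ProposeInv (misreport P m l) i s' ∧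
      remainingProposals n s' < remainingProposals n s ∧ t ≤ 60 := by
  obtain ⟨nx, hb, cur, hinv, hrep, hcur⟩ := hI
  obtain ⟨c, rfl, -, hc⟩ := hcur.resolve_left (by rintro ⟨-, h⟩; omega)
  obtain ⟨w, hw, hidx⟩ := ((misreport P m l).men c).exists_getElem?
    ((hinv.free c rfl).2.1.trans_lt (PrefList.idxOf_lt _ _))
  set s₁ := (s.setReg .w w).setCell .next 0 c (nx c + 1) with hs₁
  set s₂ := s₁.setReg .h (s₁.tab .husb 0 w) with hs₂
  have happly : proposeStep.apply s = respond.apply s₂ := by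
    rw [proposeStep, Cmd.apply, chooseWoman_apply hs hl hc (by rwa [hrep.1])]
    simp [Cmd.apply, Expr.eval, hc, hrep.1, hs₂, hs₁]
  have hrep₂ : Represents s₂ (Function.update nx c (nx c + 1)) hb :=
    Represents.setCell_next (s := s.setReg .w w) hrep c (nx c + 1)
  have hready₂ : Ready P m s₂ :=
    ⟨by simp [s₂, s₁, hs.n_eq], by simp [s₂, s₁, hs.acc_eq], hs.mp_eq, hs.rank_eq, hs.mrank_eq⟩
  refine runs_of_loopFree rfl fun t ht => ?_
  rw [happly]
  refine ⟨proposeInv_respond hready₂ hinv hidx hrep₂ (by simp [s₂, s₁, hc]) (by simp [s₂, s₁])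
    (by simp [s₂]) (by simp [s₂, s₁, hactive]), remainingProposals_lt hinv hrep ?_,
    ht.trans (by decide)⟩
  rw [(sameOutside_apply (c := respond) rfl s₂).2 .next rfl]
  exact hrep₂.1

theorem runs_enterStep {i : Fin n} (hs : Ready P m s)
    (hl : EncodesList (s.tab .strat 0) l.toList) (hi : s.reg .i = i)
    (hinv : SeqInv (misreport P m l) i nx hb none) (hrep : Represents s nx hb) :
    Runs enterStep s fun s' t =>
      (∃ nx' hb', SeqInv (misreport P m l) (i + 1) nx' hb' none ∧ Represents s' nx' hb') ∧
      t + 64 * remainingProposals n s' ≤ 64 * remainingProposals n s + 8 := by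
  refine Runs.seq_of_loopFree rfl fun t₁ (ht₁ : t₁ ≤ 2) hs₁ => ?_
  refine Runs.seq_of_loopFree rfl fun t₂ (ht₂ : t₂ ≤ 2) hs₂ => ?_
  have hstart : ProposeInv (misreport P m l) (i + 1)
      ((s.setReg .cur (s.reg .i)).setReg .active 1) :=
    ⟨nx, hb, some i, hinv.enter, hrep, .inr ⟨i, rfl, by simp, by simp [hi]⟩⟩
  refine (runs_while (ProposeInv (misreport P m l) (i + 1))
    (fun s' => 64 * remainingProposals n s') hstart ?_).mono ?_
  · intro s' hs' hI hb
    refine (runs_proposeStep ((hs.of_sameOutside (hs₁.seq hs₂) rfl).of_sameOutside hs' rfl)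
      (by rw [hs'.2 .strat rfl]; exact hl) hI
      (by simpa [Expr.eval] using hb)).mono ?_
    rintro s'' t - ⟨hI', hlt, ht⟩
    simp only [BExpr.cost, Expr.cost]
    exact ⟨hI', by omega⟩
  · rintro s' t - ⟨⟨nx', hb', cur, hinv', hrep', hcur⟩, hidle, ht⟩
    rcases hcur with ⟨rfl, -⟩ | ⟨c, -, hactive, -⟩
    · refine ⟨⟨nx', hb', hinv', hrep'⟩, ?_⟩
      change t + 64 * remainingProposals n s' ≤ 64 * remainingProposals n s + 4 at ht
      omega
    · exact absurd (by simpa [Expr.eval] using hactive) hidle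

theorem runs_runDA (hs : Ready P m s) (hl : EncodesList (s.tab .strat 0) l.toList) :
    Runs runDA s fun s' t =>
      EncodesMatching (s'.tab .husb 0) (da (misreport P m l)) ∧ t ≤ 200 * (n * n) := by
  have hnn : n ≤ n * n := Nat.le_mul_self n
  have hpos : 0 < n := Fin.pos m
  rw [runDA_eq]
  refine Runs.seq (runs_for (N := Reg.n) (by decide) rfl rfl
    (fun k s' => ∀ j < k, s'.tab .next 0 j = 0 ∧ s'.tab .husb 0 j = n) 8 (by simp) ?_) ?_
  · intro k s' _ hs' hk hI
    refine runs_of_loopFree rfl fun t ht => ⟨fun j hj => ?_, ht.trans (by decide)⟩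
    by_cases hjk : j = k
    · simp [Cmd.apply, Expr.eval, hk, hjk, hs'.1 .n rfl, hs.n_eq]
    · simpa [Cmd.apply, Expr.eval, hk, hjk] using hI j (by omega)
  rintro s₁ t₁ hs₁ ⟨hI, ht₁⟩
  have hready := hs.of_sameOutside hs₁ rfl
  rw [hs.n_eq] at hI ht₁
  refine (runs_for_amortized (N := Reg.n) (by decide) rfl rfl
    (fun k s' => ∃ nx hb, SeqInv (misreport P m l) k nx hb none ∧ Represents s' nx hb)
    (fun s' => 64 * remainingProposals n s') 8
    ⟨_, _, .init _, fun j => (hI j j.2).1, fun w => (hI w w.2).2⟩ ?_).mono ?_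
  · rintro k s' hk hs' hki ⟨nx, hb, hinv, hrep⟩
    rw [hready.n_eq] at hk
    exact runs_enterStep (i := ⟨k, hk⟩) (hready.of_sameOutside hs' rfl)
      (by rwa [hs'.2 .strat rfl, hs₁.2 .strat rfl]) hki hinv hrep
  · rintro s' t - ⟨⟨nx, hb, hinv, hrep⟩, ht⟩
    rw [hready.n_eq] at hinv ht
    refine ⟨fun w => by rw [hrep.2 w, hinv.eq_da w, Option.elim_some], ?_⟩
    have hremaining : remainingProposals n (s₁.setReg .i 0) ≤ n * n := Nat.sub_le _ _
    omega

end RunDA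

end Program

/-! ## The steps of the greedy program -/

section Encodings

variable {n : ℕ} {f g : ℕ → ℕ} {L : List (Fin n)} {l : PrefList n} {X : Finset (Fin n)} {k : ℕ}
  {a : Fin n}

theorem EncodesList.append (h : EncodesList f L) (hg : g L.length = a)
    (hgf : ∀ k < L.length, g k = f k) : EncodesList g (L ++ [a]) := by
  intro k b hk
  rcases lt_trichotomy k L.length with hlt | rfl | hgt
  · rw [List.getElem?_append_left hlt] at hk
    rw [hgf k hlt, h k b hk]
  · obtain rfl : a = b := by simpa using hk
    exact hg
  · rw [List.getElem?_eq_none (by simpa using hgt)] at hk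
    cases hk

/-- The row `f` of a table gives the positions of the first `k` entries of the list `l`. -/
def EncodesPositions (f : ℕ → ℕ) (l : PrefList n) (k : ℕ) : Prop :=
  ∀ a : Fin n, l.toList.idxOf a < k → f a = l.toList.idxOf a

theorem EncodesPositions.succ (h : EncodesPositions f l k) (ha : l.toList.idxOf a = k)
    (hg : g a = k) (hgf : ∀ b : Fin n, b ≠ a → g b = f b) : EncodesPositions g l (k + 1) := by
  intro b hb
  rcases eq_or_ne b a with rfl | hba
  · rw [hg, ha]
  · have hne : l.toList.idxOf b ≠ k := fun hbk => hba (l.idxOf_inj (hbk.trans ha.symm))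
    rw [hgf b hba, h b (by omega)]

theorem EncodesSet.insert (h : EncodesSet f X) (ha : g a = 1)
    (hgf : ∀ b : Fin n, b ≠ a → g b = f b) : EncodesSet g (insert a X) := by
  intro b
  rcases eq_or_ne b a with rfl | hba <;> simp [*, h b]

theorem EncodesSet.erase (h : EncodesSet f X) (ha : g a = 0)
    (hgf : ∀ b : Fin n, b ≠ a → g b = f b) : EncodesSet g (X.erase a) := by
  intro b
  rcases eq_or_ne b a with rfl | hba <;> simp [*, h b]

theorem EncodesSet.sum_eq_card (h : EncodesSet f X) : ∑ w : Fin n, f w = X.card := by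
  simp [h _]

end Encodings

namespace Program

variable {n : ℕ} {P : Profile n} {m : Fin n} {s : State Reg Tab}

section Prepare

/-- Part of `prepare`: the positions of the men in the list of the woman `i`. -/
def rankMen : Cmd Reg Tab :=
  .for .j (v .n) (.store .rank (v .i) (.cell .wp (v .i) (v .j)) (v .j))

/-- Part of `prepare`: the positions of the women in the list of the accomplice, and a copy of that
list. -/
def readAccomplice : Cmd Reg Tab :=
  .for .j (v .n)
    (put1 .mrank (.cell .mp (v .acc) (v .j)) (v .j) ;;
     put1 .strat (v .j) (.cell .mp (v .acc) (v .j)))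

theorem prepare_eq : prepare = (.for .i (v .n) rankMen ;; readAccomplice) :=
  rfl

theorem runs_rankMen {i : Fin n} (hn : s.reg .n = n) (hi : s.reg .i = i)
    (hwp : s.tab .wp = encodeLists P.women) :
    Runs rankMen s fun s' t => EncodesPositions (s'.tab .rank i) (P.women i) n ∧
      (∀ w : ℕ, w ≠ i → s'.tab .rank w = s.tab .rank w) ∧ t ≤ 20 * n := by
  have hpos : 0 < n := Fin.pos i
  refine (runs_for (N := Reg.n) (by decide) rfl rfl (fun k s' =>
    EncodesPositions (s'.tab .rank i) (P.women i) k ∧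
      ∀ w : ℕ, w ≠ i → s'.tab .rank w = s.tab .rank w) 6 ?_ ?_).mono ?_
  · exact ⟨fun _ h => absurd h (Nat.not_lt_zero _), fun _ _ => rfl⟩
  · rintro k s' hk hs' hj ⟨hrank, hsame⟩
    obtain ⟨u, hu, huk⟩ := (P.women i).exists_getElem? (hn ▸ hk)
    have henc := encodesList_encodeLists P.women i k u hu
    refine runs_of_loopFree rfl fun t ht => ⟨⟨?_, fun w hw => ?_⟩, ht.trans (by decide)⟩
    · refine hrank.succ huk ?_ fun b hb => ?_ <;>
        simp_all [Cmd.apply, Expr.eval, hs'.1 .i rfl, hs'.2 .wp rfl, Fin.val_inj]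
    · funext j
      simp [Cmd.apply, Expr.eval, hs'.1 .i rfl, hi, hw, hsame w hw]
  · rintro s' t - ⟨⟨hrank, hsame⟩, ht⟩
    rw [hn] at hrank ht
    exact ⟨hrank, hsame, by omega⟩

theorem runs_rankAllMen (hpos : 0 < n) (hn : s.reg .n = n) (hwp : s.tab .wp = encodeLists P.women) :
    Runs (.for .i (v .n) rankMen) s fun s' t =>
      (∀ w j : Fin n, s'.tab .rank w j = (P.women w).toList.idxOf j) ∧ t ≤ 40 * (n * n) := by
  refine (runs_for (N := Reg.n) (by decide) rfl rfl (fun k s' =>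
    ∀ w : Fin n, w < k → EncodesPositions (s'.tab .rank w) (P.women w) n) (20 * n) ?_ ?_).mono ?_
  · exact fun _ h => absurd h (Nat.not_lt_zero _)
  · intro k s' hk hs' hi hI
    rw [hn] at hk
    refine (runs_rankMen (i := ⟨k, hk⟩) ((hs'.1 .n rfl).trans hn) hi
      ((hs'.2 .wp rfl).trans hwp)).mono ?_
    rintro s'' t - ⟨hrank, hsame, ht⟩
    refine ⟨fun w hw => ?_, ht⟩
    rcases Nat.lt_succ_iff_lt_or_eq.1 hw with hlt | rfl
    · rw [State.setReg_tab, hsame w hlt.ne]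
      exact hI w hlt
    · exact hrank
  · rintro s' t - ⟨hrank, ht⟩
    rw [hn] at hrank ht
    refine ⟨fun w j => hrank w w.2 j ((P.women w).idxOf_lt j), ?_⟩
    nlinarith

theorem runs_readAccomplice (hn : s.reg .n = n) (hacc : s.reg .acc = m)
    (hmp : s.tab .mp = encodeLists P.men) :
    Runs readAccomplice s fun s' t =>
      (∀ w : Fin n, s'.tab .mrank 0 w = (P.men m).toList.idxOf w) ∧
      EncodesList (s'.tab .strat 0) (P.men m).toList ∧ t ≤ 40 * n := by
  have hpos : 0 < n := Fin.pos m
  refine (runs_for (N := Reg.n) (by decide) rfl rfl (fun k s' =>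
    EncodesPositions (s'.tab .mrank 0) (P.men m) k ∧
      EncodesList (s'.tab .strat 0) ((P.men m).toList.take k)) 20 ?_ ?_).mono ?_
  · exact ⟨fun _ h => absurd h (Nat.not_lt_zero _), fun _ _ h => by simp at h⟩
  · rintro k s' hk hs' hj ⟨hmrank, hstrat⟩
    rw [hn] at hk
    obtain ⟨u, hu, huk⟩ := (P.men m).exists_getElem? hk
    have henc := encodesList_encodeLists P.men m k u hu
    have hlen : ((P.men m).toList.take k).length = k := by
      simp [(P.men m).length_eq, hk.le]
    refine runs_of_loopFree rfl fun t ht => ⟨⟨?_, ?_⟩, ht.trans (by decide)⟩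
    · refine hmrank.succ huk ?_ fun b hb => ?_ <;>
        simp_all [Cmd.apply, Expr.eval, hs'.1 .acc rfl, hs'.2 .mp rfl, Fin.val_inj]
    · rw [List.take_add_one, hu]
      refine hstrat.append ?_ fun j hj' => ?_ <;> rw [hlen] at *
      · simp [Cmd.apply, Expr.eval, hj, hs'.1 .acc rfl, hs'.2 .mp rfl, hacc, hmp, henc]
      · simp [Cmd.apply, Expr.eval, hj, hj'.ne]
  · rintro s' t - ⟨⟨hmrank, hstrat⟩, ht⟩
    rw [hn] at hmrank hstrat ht
    rw [List.take_of_length_le (P.men m).length_eq.le] at hstrat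
    exact ⟨fun w => hmrank w ((P.men m).idxOf_lt w), hstrat, by omega⟩

theorem runs_prepare (P : Profile n) (m : Fin n) :
    Runs prepare (initState P m) fun s t =>
      Ready P m s ∧ EncodesList (s.tab .strat 0) (P.men m).toList ∧ t ≤ 100 * (n * n) := by
  have hnn : n ≤ n * n := Nat.le_mul_self n
  rw [prepare_eq]
  refine Runs.seq (runs_rankAllMen (Fin.pos m) rfl rfl) ?_
  rintro s₁ t₁ hs₁ ⟨hrank, ht₁⟩
  have hn : s₁.reg .n = n := hs₁.1 .n rfl
  have hacc : s₁.reg .acc = m := hs₁.1 .acc rfl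
  have hmp : s₁.tab .mp = encodeLists P.men := hs₁.2 .mp rfl
  refine (runs_readAccomplice hn hacc hmp).mono ?_
  rintro s₂ t₂ hs₂ ⟨hmrank, hstrat, ht₂⟩
  exact ⟨⟨(hs₂.1 .n rfl).trans hn, (hs₂.1 .acc rfl).trans hacc, (hs₂.2 .mp rfl).trans hmp,
    by rwa [hs₂.2 .rank rfl], hmrank⟩, hstrat, by omega⟩

end Prepare

theorem runs_findPartner (hs : Ready P m s) {μ : Fin n ≃ Fin n}
    (hμ : EncodesMatching (s.tab .husb 0) μ) {out : Reg} (hout : out = .a ∨ out = .r) :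
    Runs (findPartner out) s fun s' t => s'.reg out = μ m ∧ t ≤ 30 * n := by
  have hpos : 0 < n := Fin.pos m
  have hne : out ≠ .i := by rcases hout with rfl | rfl <;> decide
  refine (runs_for (N := Reg.n) (by decide) (by rcases hout with rfl | rfl <;> rfl)
    (by rcases hout with rfl | rfl <;> rfl) (fun k s' => μ m < k → s'.reg out = μ m) 9
    (fun h => absurd h (Nat.not_lt_zero _)) ?_).mono ?_
  · intro k s' hk hs' hki hI
    rw [hs.n_eq] at hk
    have hacc : s'.reg .acc = m :=
      (hs'.1 .acc (by rcases hout with rfl | rfl <;> rfl)).trans hs.acc_eq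
    have hhusb : s'.tab .husb 0 k = μ.symm ⟨k, hk⟩ := by
      rw [hs'.2 .husb rfl]
      exact hμ ⟨k, hk⟩
    have hiff : ((μ.symm ⟨k, hk⟩ : Fin n) : ℕ) = m ↔ k = μ m := by
      rw [Fin.val_inj, Equiv.symm_apply_eq, ← Fin.val_inj]
    refine runs_of_loopFree rfl fun t ht => ⟨fun h => ?_, ht.trans (by rfl)⟩
    by_cases hkm : k = μ m
    · simp [Cmd.apply, Expr.eval, hki, hacc, hhusb, hne, hiff.2 hkm, ← hkm]
    · simpa [Cmd.apply, Expr.eval, hki, hacc, hhusb, hne, mt hiff.1 hkm] using hI (by omega)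
  · rintro s' t - ⟨h, ht⟩
    rw [hs.n_eq] at h ht
    exact ⟨h (μ m).2, by omega⟩

end Program

/-- The situation in which the accomplice is to push up the set `X`. -/
structure Current {n : ℕ} (P : Profile n) (m : Fin n) (X : Finset (Fin n))
    (s : State Reg Tab) : Prop where
  ready : Ready P m s
  a_eq : s.reg .a = da P m
  ys_eq : EncodesSet (s.tab .ys 0) X

theorem Current.of_sameOutside {n : ℕ} {P : Profile n} {m : Fin n} {X : Finset (Fin n)}
    {s s' : State Reg Tab} {c : Cmd Reg Tab} (h : Current P m X s) (hs : SameOutside c s s')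
    (hc : (c.writesReg .n || c.writesReg .acc || c.writesTab .mp || c.writesTab .rank ||
      c.writesTab .mrank) = false) (ha : c.writesReg .a = false) (hys : c.writesTab .ys = false) :
    Current P m X s' :=
  ⟨h.ready.of_sameOutside hs hc, (hs.1 _ ha).trans h.a_eq, by rw [hs.2 _ hys]; exact h.ys_eq⟩

/-- The part of `strat` written so far, up to the position `pos`, is the list `L`. -/
def StratIs {n : ℕ} (s : State Reg Tab) (L : List (Fin n)) : Prop :=
  s.reg .pos = L.length ∧ EncodesList (s.tab .strat 0) L

namespace Program

variable {n : ℕ} {P : Profile n} {m : Fin n} {X : Finset (Fin n)} {s : State Reg Tab}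

section BuildPushUp

variable {L : List (Fin n)} {b : BExpr Reg Tab} {p : Fin n → Bool} {w : Fin n}

/-- Part of `buildPushUp`: append the women who satisfy `b` to `strat`, in the order of the true
list of the accomplice. -/
def appendWhere (b : BExpr Reg Tab) : Cmd Reg Tab :=
  .for .i (v .n) (.set .w (.cell .mp (v .acc) (v .i)) ;; .ite b (append (v .w)) .skip)

theorem buildPushUp_eq : buildPushUp =
    (.set .pos (.const 0) ;; appendWhere (.and (.not (.eq (v .w) (v .a))) goesUp) ;;
      append (v .a) ;; appendWhere (.and (.not (.eq (v .w) (v .a))) (.not goesUp))) :=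
  rfl

theorem append_apply_stratIs {e : Expr Reg Tab} (h : StratIs s L) (he : e.eval s = w) :
    StratIs ((append e).apply s) (L ++ [w]) := by
  refine ⟨by simp [append, Cmd.apply, Expr.eval, h.1], h.2.append ?_ fun k hk => ?_⟩
  · simp [append, Cmd.apply, Expr.eval, h.1, he]
  · simp [append, Cmd.apply, Expr.eval, h.1, hk.ne]

theorem runs_appendWhere (hs : Current P m X s)
    (hb : ∀ s', Current P m X s' → ∀ w : Fin n, s'.reg .w = w → (b.eval s' = true ↔ p w = true))
    (hL : StratIs s L) :
    Runs (appendWhere b) s fun s' t =>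
      StratIs s' (L ++ (P.men m).toList.filter p) ∧ t ≤ (b.cost + 20) * n + 6 := by
  refine (runs_for (N := Reg.n) (by decide) rfl rfl
    (fun k s' => StratIs s' (L ++ ((P.men m).toList.take k).filter p))
    (b.cost + 13) (by simpa [StratIs] using hL) ?_).mono ?_
  · intro k s' hk hs' hki hI
    have hs₁ := hs.of_sameOutside hs' rfl rfl rfl
    rw [hs.ready.n_eq] at hk
    obtain ⟨w, hw, -⟩ := (P.men m).exists_getElem? hk
    have hset : (Cmd.set .w (.cell .mp (v .acc) (v .i))).apply s' = s'.setReg .w w := by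
      simp [Cmd.apply, Expr.eval, hs₁.ready.acc_eq, hs₁.ready.mp_eq, hki,
        encodesList_encodeLists P.men m k w hw]
    have hbw := hb (s'.setReg .w w)
      (hs₁.of_sameOutside (.setReg s' .w (v .w) w) rfl rfl rfl) w (by simp)
    refine runs_of_loopFree rfl fun t ht => ⟨?_, ht.trans ?_⟩
    · suffices h : StratIs ((Cmd.ite b (append (v .w)) .skip).apply (s'.setReg .w w))
          (L ++ ((P.men m).toList.take (k + 1)).filter p) by
        rwa [Cmd.apply, hset]
      rw [List.take_add_one, hw, Option.toList_some, List.filter_append, ← List.append_assoc,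
        Cmd.apply]
      split_ifs with h
      · rw [List.filter_cons_of_pos (hbw.1 h)]
        exact append_apply_stratIs hI (by simp [Expr.eval])
      · rw [List.filter_cons_of_neg (mt hbw.2 h), List.filter_nil, List.append_nil]
        exact hI
    · simp only [Cmd.size, Expr.cost, append]
      omega
  · rintro s' t - ⟨h, ht⟩
    rw [hs.ready.n_eq] at h ht
    rw [List.take_of_length_le (P.men m).length_eq.le] at h
    exact ⟨h, ht⟩

theorem eval_goesUp (hs : Current P m X s) (hw : s.reg .w = w) :
    goesUp.eval s = true ↔ (P.men m).Prefers w (da P m) ∨ w ∈ X := by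
  simp [goesUp, Expr.eval, hw, hs.a_eq, hs.ready.mrank_eq, hs.ys_eq w, PrefList.Prefers]

theorem eval_ne_a (hs : Current P m X s) (hw : s.reg .w = w) :
    (BExpr.not (.eq (v .w) (v .a))).eval s = true ↔ w ≠ da P m := by
  simp [Expr.eval, hw, hs.a_eq, Fin.val_inj]

theorem runs_buildPushUp (hs : Current P m X s) :
    Runs buildPushUp s fun s' t =>
      EncodesList (s'.tab .strat 0) (pushUp P m X).toList ∧ t ≤ 100 * n := by
  have hpos : 0 < n := Fin.pos m
  rw [buildPushUp_eq]
  refine Runs.seq_of_loopFree rfl fun t₁ (ht₁ : t₁ ≤ 2) hs₁ => ?_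
  have hc₁ := hs.of_sameOutside hs₁ rfl rfl rfl
  refine Runs.seq (runs_appendWhere hc₁ (L := [])
    (p := fun w => w ≠ da P m ∧ ((P.men m).Prefers w (da P m) ∨ w ∈ X))
    (fun s' hs' w hw => ?_) ⟨by simp [Cmd.apply, Expr.eval], fun _ _ h => by simp at h⟩) ?_
  · rw [BExpr.eval_and_iff, eval_ne_a hs' hw, eval_goesUp hs' hw, decide_eq_true_eq]
  rintro s₂ t₂ hs₂ ⟨hL, ht₂⟩
  have hc₂ := hc₁.of_sameOutside hs₂ rfl rfl rfl
  refine Runs.seq_of_loopFree rfl fun t₃ (ht₃ : t₃ ≤ 7) hs₃ => ?_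
  refine (runs_appendWhere (hc₂.of_sameOutside hs₃ rfl rfl rfl)
    (p := fun w => w ≠ da P m ∧ ¬ ((P.men m).Prefers w (da P m) ∨ w ∈ X))
    (fun s' hs' w hw => ?_) (append_apply_stratIs hL hc₂.a_eq)).mono ?_
  · rw [BExpr.eval_and_iff, BExpr.eval_not_iff (b := goesUp), eval_ne_a hs' hw,
      eval_goesUp hs' hw, decide_eq_true_eq]
  · rintro s₄ t₄ - ⟨⟨-, hL₄⟩, ht₄⟩
    simp only [goesUp, BExpr.cost, Expr.cost] at ht₂ ht₄
    exact ⟨by simpa [pushUp, PrefList.pushAbove] using hL₄, by omega⟩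

/-- Stated with a continuation `c`, since `;;` associates to the right. -/
theorem runs_buildPushUp_runDA (hs : Current P m X s) {c : Cmd Reg Tab}
    {Q : State Reg Tab → ℕ → Prop}
    (hc : ∀ s' t, SameOutside (buildPushUp ;; runDA) s s' →
      EncodesMatching (s'.tab .husb 0) (daPushUp P m X) → t ≤ 300 * (n * n) →
      Runs c s' fun s'' t' => Q s'' (t + t')) :
    Runs (buildPushUp ;; runDA ;; c) s Q := by
  have hnn : n ≤ n * n := Nat.le_mul_self n
  refine Runs.seq (runs_buildPushUp hs) ?_
  rintro s₁ t₁ hs₁ ⟨hL, ht₁⟩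
  refine Runs.seq (runs_runDA (hs.ready.of_sameOutside hs₁ rfl) hL) ?_
  rintro s₂ t₂ hs₂ ⟨hh, ht₂⟩
  refine (hc s₂ (t₁ + t₂) (hs₁.seq hs₂) hh (by omega)).mono fun s' t _ h => ?_
  rwa [← Nat.add_assoc]

end BuildPushUp

section NoRegret

variable {w : Fin n}

/-- Part of `computeNoRegretSet`: decide whether the woman `y` belongs to the no-regret set, from
the partner `r` that the accomplice has after pushing her up, and take her out of `ys` again. -/
def recordVerdict : Cmd Reg Tab :=
  .ite (.lt (at1 .mrank (v .a)) (at1 .mrank (v .r)))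
    (put1 .nr (v .y) (.const 0))
    (put1 .nr (v .y) (.const 1)) ;;
  put1 .ys (v .y) (.const 0)

/-- The body of the main loop of `computeNoRegretSet`. -/
def testWoman : Cmd Reg Tab :=
  put1 .ys (v .y) (.const 1) ;; buildPushUp ;; runDA ;; findPartner .r ;; recordVerdict

theorem computeNoRegretSet_eq : computeNoRegretSet =
    (.for .y (v .n) (put1 .ys (v .y) (.const 0)) ;; .for .y (v .n) testWoman) :=
  rfl

theorem recordVerdict_apply (hs : Current P m {w} s) (hy : s.reg .y = w)
    (hr : s.reg .r = daPushUp P m {w} m) :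
    recordVerdict.apply s =
      (s.setCell .nr 0 w (if w ∈ noRegretSet P m then 1 else 0)).setCell .ys 0 w 0 := by
  have hiff : s.tab .mrank 0 (s.reg .a) < s.tab .mrank 0 (s.reg .r) ↔ w ∉ noRegretSet P m := by
    rw [mem_noRegretSet, NoRegret, ← PrefList.not_prefers, not_not, hs.a_eq, hr,
      hs.ready.mrank_eq, hs.ready.mrank_eq]
    rfl
  by_cases hw : w ∈ noRegretSet P m <;>
    simp [recordVerdict, Cmd.apply, Expr.eval, hiff, hy, hw]

theorem runs_testWoman (hs : Current P m ∅ s) (hy : s.reg .y = w) :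
    Runs testWoman s fun s' t =>
      EncodesSet (s'.tab .ys 0) (∅ : Finset (Fin n)) ∧
      s'.tab .nr 0 w = (if w ∈ noRegretSet P m then 1 else 0) ∧
      (∀ w' : Fin n, w' ≠ w → s'.tab .nr 0 w' = s.tab .nr 0 w') ∧ t ≤ 400 * (n * n) := by
  have hnn : n ≤ n * n := Nat.le_mul_self n
  refine Runs.seq_of_loopFree rfl fun t₁ (ht₁ : t₁ ≤ 4) hs₁ => ?_
  have hc₁ : Current P m {w} ((put1 .ys (v .y) (.const 1)).apply s) := by
    refine ⟨hs.ready.of_sameOutside hs₁ rfl, hs.a_eq, hs.ys_eq.insert ?_ fun u hu => ?_⟩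
    · simp [Cmd.apply, Expr.eval, hy]
    · simp [Cmd.apply, Expr.eval, hy, Fin.val_inj, hu]
  refine runs_buildPushUp_runDA hc₁ fun s₂ t₂ hs₂ hhusb ht₂ => ?_
  have hc₂ := hc₁.of_sameOutside hs₂ rfl rfl rfl
  refine Runs.seq (runs_findPartner hc₂.ready hhusb (Or.inr rfl)) ?_
  rintro s₃ t₃ hs₃ ⟨hr, ht₃⟩
  have hc₃ := hc₂.of_sameOutside hs₃ rfl rfl rfl
  have hout := hs₁.seq (hs₂.seq hs₃)
  have hy₃ : s₃.reg .y = w := (hout.1 .y rfl).trans hy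
  refine runs_of_loopFree rfl fun t₄ (ht₄ : t₄ ≤ 20) => ?_
  rw [recordVerdict_apply hc₃ hy₃ hr]
  refine ⟨?_, by simp, fun w' hw' => by simp [Fin.val_inj, hw', hout.2 .nr rfl], by omega⟩
  rw [← Finset.erase_singleton w]
  exact hc₃.ys_eq.erase (by simp) fun u hu => by simp [Fin.val_inj, hu]

theorem runs_computeNoRegretSet (hs : Ready P m s) (ha : s.reg .a = da P m) :
    Runs computeNoRegretSet s fun s' t =>
      EncodesSet (s'.tab .nr 0) (noRegretSet P m) ∧ t ≤ 500 * (n * n * n) := by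
  have hpos : 0 < n := Fin.pos m
  rw [computeNoRegretSet_eq]
  refine Runs.seq (runs_fill (N := Reg.n) (by decide) _ _ (fun _ => 0) fun _ _ _ _ _ => rfl) ?_
  rintro s₁ t₁ hs₁ ⟨hys, ht₁⟩
  rw [hs.n_eq] at hys ht₁
  have hc₁ : Current P m ∅ s₁ := ⟨hs.of_sameOutside hs₁ rfl, (hs₁.1 .a rfl).trans ha,
    fun w => by simpa using hys w w.2⟩
  refine (runs_for (N := Reg.n) (by decide) rfl rfl (fun k s' =>
    EncodesSet (s'.tab .ys 0) (∅ : Finset (Fin n)) ∧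
      ∀ w : Fin n, w < k → s'.tab .nr 0 w = if w ∈ noRegretSet P m then 1 else 0)
    (400 * (n * n)) ?_ ?_).mono ?_
  · exact ⟨hc₁.ys_eq, fun _ h => absurd h (Nat.not_lt_zero _)⟩
  · rintro k s' hk hs' hy ⟨hempty, hnr⟩
    rw [hc₁.ready.n_eq] at hk
    have hc' : Current P m ∅ s' :=
      ⟨hc₁.ready.of_sameOutside hs' rfl, (hs'.1 .a rfl).trans hc₁.a_eq, hempty⟩
    refine (runs_testWoman (w := ⟨k, hk⟩) hc' hy).mono ?_
    rintro s'' t - ⟨hempty', hnr_k, hnr_ne, ht⟩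
    refine ⟨⟨hempty', fun w hw => ?_⟩, ht⟩
    rcases eq_or_ne w ⟨k, hk⟩ with rfl | hne
    · exact hnr_k
    · have hwk : (w : ℕ) ≠ k := fun h => hne (Fin.ext h)
      exact (hnr_ne w hne).trans (hnr w (by omega))
  · rintro s' t - ⟨⟨-, hnr⟩, ht⟩
    rw [hc₁.ready.n_eq] at hnr ht
    refine ⟨fun w => hnr w w.2, ?_⟩
    simp only [Expr.cost] at ht₁
    have hn3 : n ≤ n * n * n := by nlinarith [Nat.mul_le_mul hpos hpos]
    linarith

end NoRegret

end Program

section GreedyProgress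

variable {n : ℕ} {P : Profile n} {m : Fin n} {Y : Finset (Fin n)} {w : Fin n} {k : ℕ}

/-- The state of a run of the greedy algorithm that tries the women in the order of their indices:
`Y` has been reached by successful removals, and the women of `Y` with index below `k` cannot be
removed. -/
structure GreedyProgress (P : Profile n) (m : Fin n) (Y : Finset (Fin n)) (k : ℕ) : Prop where
  reachable : Relation.ReflTransGen (GreedyStep P m) (noRegretSet P m) Y
  irremovable : ∀ w ∈ Y, w < k → daPushUp P m (Y.erase w) ≠ daPushUp P m (noRegretSet P m)

namespace GreedyProgress

theorem init (P : Profile n) (m : Fin n) : GreedyProgress P m (noRegretSet P m) 0 :=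
  ⟨.refl, fun _ _ h => absurd h (Nat.not_lt_zero _)⟩

theorem erase (h : GreedyProgress P m Y k) (hw : w ∈ Y)
    (heq : daPushUp P m (Y.erase w) = daPushUp P m (noRegretSet P m)) :
    GreedyProgress P m (Y.erase w) 0 :=
  ⟨h.reachable.tail ⟨w, hw, rfl, heq⟩, fun _ _ h => absurd h (Nat.not_lt_zero _)⟩

theorem succ (h : GreedyProgress P m Y w)
    (hw : w ∈ Y → daPushUp P m (Y.erase w) ≠ daPushUp P m (noRegretSet P m)) :
    GreedyProgress P m Y (w + 1) := by
  refine ⟨h.reachable, fun u hu hlt => ?_⟩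
  rcases eq_or_ne u w with rfl | hne
  · exact hw hu
  · have huw : (u : ℕ) ≠ w := fun heq => hne (Fin.ext heq)
    exact h.irremovable u hu (by omega)

theorem greedyReturns (h : GreedyProgress P m Y n) : GreedyReturns P m Y := by
  refine ⟨h.reachable, ?_⟩
  rintro _ ⟨w, hw, rfl, heq⟩
  exact h.irremovable w hw w.2 heq

end GreedyProgress

end GreedyProgress

/-- The invariant of `greedyLoop`. -/
structure GreedyInv {n : ℕ} (P : Profile n) (m : Fin n) (Y : Finset (Fin n))
    (s : State Reg Tab) : Prop where
  current : Current P m Y s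
  best_eq : EncodesMatching (s.tab .best 0) (daPushUp P m (noRegretSet P m))
  y_le : s.reg .y ≤ n
  progress : GreedyProgress P m Y (s.reg .y)

/-- A bound for the number of iterations that `greedyLoop` can still make. A removal costs one woman
and resets `y`, hence the weight `n + 1`. -/
def greedyPotential (n : ℕ) (s : State Reg Tab) : ℕ :=
  (∑ w : Fin n, s.tab .ys 0 w) * (n + 1) + (n - s.reg .y)

theorem EncodesSet.greedyPotential_le {n : ℕ} {X : Finset (Fin n)} {s : State Reg Tab}
    (h : EncodesSet (s.tab .ys 0) X) : greedyPotential n s ≤ 3 * (n * n) := by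
  have hcard : X.card ≤ n := by simpa using X.card_le_univ
  have hnn : n ≤ n * n := Nat.le_mul_self n
  calc greedyPotential n s = X.card * (n + 1) + (n - s.reg .y) := by
        rw [greedyPotential, h.sum_eq_card]
    _ ≤ n * (n + 1) + n := Nat.add_le_add (Nat.mul_le_mul_right _ hcard) (Nat.sub_le _ _)
    _ ≤ 3 * (n * n) := by linarith

namespace Program

variable {n : ℕ} {P : Profile n} {m : Fin n} {Y : Finset (Fin n)} {s : State Reg Tab} {w : Fin n}

section Greedy

theorem runs_compare {μ ν : Fin n ≃ Fin n} (hs : Ready P m s)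
    (hμ : EncodesMatching (s.tab .husb 0) μ) (hν : EncodesMatching (s.tab .best 0) ν) :
    Runs compare s fun s' t => (s'.reg .same = 1 ↔ μ = ν) ∧ t ≤ 20 * n + 10 := by
  refine Runs.seq_of_loopFree rfl fun t₁ (ht₁ : t₁ ≤ 2) _ => ?_
  change Runs _ (s.setReg .same 1) _
  have hn : (s.setReg .same 1).reg .n = n := hs.n_eq
  refine (runs_for (N := Reg.n) (by decide) rfl rfl (fun k s' =>
    (s'.reg .same = 1 ↔ ∀ j < k, s.tab .husb 0 j = s.tab .best 0 j)) 13 (by simp) ?_).mono ?_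
  · intro k s' _ hs' hki hI
    have hhusb : s'.tab .husb = s.tab .husb := hs'.2 _ rfl
    have hbest : s'.tab .best = s.tab .best := hs'.2 _ rfl
    refine runs_of_loopFree rfl fun t ht => ⟨?_, ht.trans (by decide)⟩
    simp only [Nat.lt_succ_iff_lt_or_eq, or_imp, forall_and, forall_eq]
    by_cases hk : s.tab .husb 0 k = s.tab .best 0 k
    · simpa [Cmd.apply, Expr.eval, hhusb, hbest, hki, hk] using hI
    · simp [Cmd.apply, Expr.eval, hhusb, hbest, hki, hk]
  · rintro s' t - ⟨h, ht⟩
    rw [hn] at h ht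
    refine ⟨h.trans ⟨fun heq => ?_, ?_⟩, by omega⟩
    · refine Equiv.symm_bijective.injective (Equiv.ext fun w => Fin.ext ?_)
      rw [← hμ w, heq w w.2, hν w]
    · rintro rfl j hj
      exact (hμ ⟨j, hj⟩).trans (hν ⟨j, hj⟩).symm

/-- Part of `greedyLoop`: restart with the smaller set if the matching is unchanged, and otherwise
put the woman `y` back and go on. -/
def restartOrRestore : Cmd Reg Tab :=
  .ite (.eq (v .same) (.const 1))
    (.set .y (.const 0))
    (put1 .ys (v .y) (.const 1) ;; .set .y (.succ (v .y)))

/-- Part of `greedyLoop`: try to remove the woman `y` from the current set. -/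
def tryRemove : Cmd Reg Tab :=
  put1 .ys (v .y) (.const 0) ;; buildPushUp ;; runDA ;; compare ;; restartOrRestore

/-- The body of `greedyLoop`. -/
def visitWoman : Cmd Reg Tab :=
  .ite (.eq (at1 .ys (v .y)) (.const 1)) tryRemove (.set .y (.succ (v .y)))

theorem greedyLoop_eq : greedyLoop =
    (.set .y (.const 0) ;; .while (.lt (v .y) (v .n)) visitWoman) :=
  rfl

theorem restartOrRestore_apply (hs : Current P m (Y.erase w) s)
    (hbest : EncodesMatching (s.tab .best 0) (daPushUp P m (noRegretSet P m)))
    (hy : s.reg .y = w) (hw : w ∈ Y) (hprogress : GreedyProgress P m Y w)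
    (hsame : s.reg .same = 1 ↔ daPushUp P m (Y.erase w) = daPushUp P m (noRegretSet P m)) :
    ∃ Y', GreedyInv P m Y' (restartOrRestore.apply s) ∧
      greedyPotential n (restartOrRestore.apply s) < Y.card * (n + 1) + (n - w) := by
  by_cases heq : s.reg .same = 1
  · have hstate : restartOrRestore.apply s = s.setReg .y 0 := by
      simp [restartOrRestore, Cmd.apply, Expr.eval, heq]
    have hc : Current P m (Y.erase w) (s.setReg .y 0) :=
      hs.of_sameOutside (.setReg s .y (.const 0) 0) rfl rfl rfl
    rw [hstate]
    refine ⟨Y.erase w, ⟨hc, hbest, by simp, by simpa using hprogress.erase hw (hsame.1 heq)⟩, ?_⟩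
    rw [greedyPotential, hc.ys_eq.sum_eq_card, ← Finset.card_erase_add_one hw, Nat.add_mul,
      State.setReg_reg, if_pos rfl]
    omega
  · have hstate : restartOrRestore.apply s = (s.setCell .ys 0 w 1).setReg .y (w + 1) := by
      simp [restartOrRestore, Cmd.apply, Expr.eval, heq, hy]
    have hc : Current P m Y (restartOrRestore.apply s) := by
      refine ⟨hs.ready.of_sameOutside (sameOutside_apply rfl s) rfl,
        ((sameOutside_apply rfl s).1 .a rfl).trans hs.a_eq, ?_⟩
      rw [hstate, ← Finset.insert_erase hw]
      exact hs.ys_eq.insert (by simp) fun u hu => by simp [Fin.val_inj, hu]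
    rw [hstate] at hc ⊢
    refine ⟨Y, ⟨hc, hbest, by simp, by simpa using hprogress.succ fun _ => mt hsame.2 heq⟩, ?_⟩
    rw [greedyPotential, hc.ys_eq.sum_eq_card, State.setReg_reg, if_pos rfl]
    omega

theorem runs_tryRemove (hs : GreedyInv P m Y s) (hy : s.reg .y = w) (hw : w ∈ Y) :
    Runs tryRemove s fun s' t =>
      (∃ Y', GreedyInv P m Y' s') ∧ greedyPotential n s' < greedyPotential n s ∧
        t ≤ 350 * (n * n) := by
  have hpos : 0 < n := Fin.pos m
  have hnn : n ≤ n * n := Nat.le_mul_self n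
  refine Runs.seq_of_loopFree rfl fun t₁ (ht₁ : t₁ ≤ 4) hs₁ => ?_
  have hc₁ : Current P m (Y.erase w) ((put1 .ys (v .y) (.const 0)).apply s) := by
    refine ⟨hs.current.ready.of_sameOutside hs₁ rfl, hs.current.a_eq,
      hs.current.ys_eq.erase ?_ fun u hu => ?_⟩
    · simp [Cmd.apply, Expr.eval, hy]
    · simp [Cmd.apply, Expr.eval, hy, Fin.val_inj, hu]
  refine runs_buildPushUp_runDA hc₁ fun s₂ t₂ hs₂ hhusb ht₂ => ?_
  have hc₂ := hc₁.of_sameOutside hs₂ rfl rfl rfl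
  have hbest₂ : EncodesMatching (s₂.tab .best 0) (daPushUp P m (noRegretSet P m)) := by
    rw [(hs₁.seq hs₂).2 .best rfl]
    exact hs.best_eq
  refine Runs.seq (runs_compare hc₂.ready hhusb hbest₂) ?_
  rintro s₃ t₃ hs₃ ⟨hsame, ht₃⟩
  have hy₃ : s₃.reg .y = w := ((hs₁.seq (hs₂.seq hs₃)).1 .y rfl).trans hy
  have hbest₃ : EncodesMatching (s₃.tab .best 0) (daPushUp P m (noRegretSet P m)) := by
    rw [hs₃.2 .best rfl]
    exact hbest₂
  obtain ⟨Y', hinv, hpotential⟩ := restartOrRestore_apply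
    (hc₂.of_sameOutside hs₃ rfl rfl rfl) hbest₃ hy₃ hw (hy ▸ hs.progress) hsame
  refine runs_of_loopFree rfl fun t₄ (ht₄ : t₄ ≤ 13) => ⟨⟨Y', hinv⟩, ?_, by omega⟩
  rwa [greedyPotential.eq_1 n s, hs.current.ys_eq.sum_eq_card, hy]

theorem runs_visitWoman (hs : GreedyInv P m Y s) (hy : s.reg .y < n) :
    Runs visitWoman s fun s' t =>
      (∃ Y', GreedyInv P m Y' s') ∧ greedyPotential n s' < greedyPotential n s ∧
        t ≤ 360 * (n * n) := by
  have hnn : 0 < n * n := Nat.mul_pos (Fin.pos m) (Fin.pos m)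
  obtain ⟨w, hw⟩ : ∃ w : Fin n, s.reg .y = w := ⟨⟨_, hy⟩, rfl⟩
  have hmem : (BExpr.eq (at1 .ys (v .y)) (.const 1)).eval s = true ↔ w ∈ Y := by
    simp [Expr.eval, hw, hs.current.ys_eq w]
  refine runs_ite (fun hwY => ?_) fun hwY => ?_
  · refine (runs_tryRemove hs hw (hmem.1 hwY)).mono ?_
    rintro s' t - ⟨hinv, hpotential, ht⟩
    refine ⟨hinv, hpotential, ?_⟩
    simp only [BExpr.cost, Expr.cost]
    omega
  · refine runs_of_loopFree rfl fun t (ht : t ≤ 3) => ?_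
    have hstate : (Cmd.set .y (.succ (v .y))).apply s = s.setReg .y (w + 1) := by
      simp [Cmd.apply, Expr.eval, hw]
    have hc : Current P m Y (s.setReg .y (w + 1)) :=
      hs.current.of_sameOutside (.setReg s .y (.succ (v .y)) _) rfl rfl rfl
    have hprogress : GreedyProgress P m Y (w + 1) :=
      (hw ▸ hs.progress).succ fun h => absurd (hmem.2 h) hwY
    rw [hstate]
    refine ⟨⟨Y, hc, hs.best_eq, by simp, by simpa using hprogress⟩, ?_, ?_⟩
    · simp only [greedyPotential, State.setReg_reg, State.setReg_tab, if_true]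
      omega
    · simp only [BExpr.cost, Expr.cost]
      omega

theorem runs_greedyLoop (hs : Current P m (noRegretSet P m) s)
    (hbest : EncodesMatching (s.tab .best 0) (daPushUp P m (noRegretSet P m))) :
    Runs greedyLoop s fun s' t =>
      ∃ Y, Current P m Y s' ∧ GreedyReturns P m Y ∧ t ≤ 2000 * n ^ 4 := by
  have hpos : 0 < n := Fin.pos m
  rw [greedyLoop_eq]
  refine Runs.seq_of_loopFree rfl fun t₁ (ht₁ : t₁ ≤ 2) hs₁ => ?_
  have hc₁ := hs.of_sameOutside hs₁ rfl rfl rfl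
  refine (runs_while (fun s' => ∃ Y, GreedyInv P m Y s')
    (fun s' => 400 * (n * n) * greedyPotential n s')
    ⟨_, hc₁, hbest, Nat.zero_le n, .init P m⟩ ?_).mono ?_
  · rintro s' - ⟨Y, hinv⟩ hlt
    have hy : s'.reg .y < n := by simpa [Expr.eval, hinv.current.ready.n_eq] using hlt
    refine (runs_visitWoman hinv hy).mono ?_
    rintro s'' t - ⟨hinv', hpotential, ht⟩
    refine ⟨hinv', ?_⟩
    simp only [BExpr.cost, Expr.cost]
    nlinarith [Nat.mul_pos hpos hpos]
  · rintro s' t - ⟨⟨Y, hinv⟩, hge, ht⟩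
    have hy : s'.reg .y = n :=
      hinv.y_le.antisymm (by simpa [Expr.eval, hinv.current.ready.n_eq] using hge)
    refine ⟨Y, hinv.current, (hy ▸ hinv.progress : GreedyProgress P m Y n).greedyReturns, ?_⟩
    have hpotential := Nat.mul_le_mul_left (400 * (n * n)) hc₁.ys_eq.greedyPotential_le
    have hpos4 : 0 < n ^ 4 := Nat.pow_pos hpos
    simp only [BExpr.cost, Expr.cost] at ht
    linarith [Nat.zero_le (400 * (n * n) * greedyPotential n s')]

end Greedy

section Main

/-- The second phase of `main`: the greedy algorithm, when the no-regret set is in `ys`. -/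
def reduceSet : Cmd Reg Tab :=
  buildPushUp ;; runDA ;; .for .i (v .n) (put1 .best (v .i) (at1 .husb (v .i))) ;;
    greedyLoop ;; buildPushUp

theorem main_eq : main =
    (prepare ;; runDA ;; findPartner .a ;; computeNoRegretSet ;;
      .for .y (v .n) (put1 .ys (v .y) (at1 .nr (v .y))) ;; reduceSet) :=
  rfl

theorem runs_reduceSet (hs : Current P m (noRegretSet P m) s) :
    Runs reduceSet s fun s' t =>
      ∃ Y, Outputs s' Y (pushUp P m Y) ∧ GreedyReturns P m Y ∧ t ≤ 3000 * n ^ 4 := by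
  have hpos : 0 < n := Fin.pos m
  refine runs_buildPushUp_runDA hs fun s₁ t₁ hs₁ hhusb ht₁ => ?_
  have hc₁ := hs.of_sameOutside hs₁ rfl rfl rfl
  refine Runs.seq (runs_fill (N := Reg.n) (by decide) _ _ (s₁.tab .husb 0)
    fun k s' _ hs' hk => by simp [Expr.eval, hk, hs'.2 .husb rfl]) ?_
  rintro s₂ t₂ hs₂ ⟨hbest, ht₂⟩
  rw [hc₁.ready.n_eq] at hbest ht₂
  refine Runs.seq (runs_greedyLoop (hc₁.of_sameOutside hs₂ rfl rfl rfl)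
    fun w => (hbest w w.2).trans (hhusb w)) ?_
  rintro s₃ t₃ - ⟨Y, hc₃, hY, ht₃⟩
  refine (runs_buildPushUp hc₃).mono ?_
  rintro s₄ t₄ hs₄ ⟨hL, ht₄⟩
  refine ⟨Y, ⟨(hc₃.of_sameOutside hs₄ rfl rfl rfl).ys_eq, hL⟩, hY, ?_⟩
  have hn : n ≤ n ^ 4 := Nat.le_self_pow (by decide) n
  have hn2 : n * n ≤ n ^ 4 := sq n ▸ Nat.pow_le_pow_right hpos (by decide)
  simp only [Expr.cost] at ht₂
  omega

theorem runs_main (P : Profile n) (m : Fin n) :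
    Runs main (initState P m) fun s t =>
      ∃ Y, Outputs s Y (pushUp P m Y) ∧ GreedyReturns P m Y ∧ t ≤ 5000 * n ^ 4 := by
  have hpos : 0 < n := Fin.pos m
  rw [main_eq]
  refine Runs.seq (runs_prepare P m) ?_
  rintro s₁ t₁ - ⟨hr₁, hstrat, ht₁⟩
  refine Runs.seq (runs_runDA hr₁ hstrat) ?_
  rintro s₂ t₂ hs₂ ⟨hhusb, ht₂⟩
  rw [misreport_self] at hhusb
  have hr₂ := hr₁.of_sameOutside hs₂ rfl
  refine Runs.seq (runs_findPartner hr₂ hhusb (Or.inl rfl)) ?_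
  rintro s₃ t₃ hs₃ ⟨ha, ht₃⟩
  have hr₃ := hr₂.of_sameOutside hs₃ rfl
  refine Runs.seq (runs_computeNoRegretSet hr₃ ha) ?_
  rintro s₄ t₄ hs₄ ⟨hnr, ht₄⟩
  have hr₄ := hr₃.of_sameOutside hs₄ rfl
  refine Runs.seq (runs_fill (N := Reg.n) (by decide) _ _ (s₄.tab .nr 0)
    fun k s' _ hs' hk => by simp [Expr.eval, hk, hs'.2 .nr rfl]) ?_
  rintro s₅ t₅ hs₅ ⟨hys, ht₅⟩
  rw [hr₄.n_eq] at hys ht₅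
  refine (runs_reduceSet ⟨hr₄.of_sameOutside hs₅ rfl, ((hs₄.seq hs₅).1 .a rfl).trans ha,
    fun w => (hys w w.2).trans (hnr w)⟩).mono ?_
  rintro s₆ t₆ - ⟨Y, hout, hY, ht₆⟩
  refine ⟨Y, hout, hY, ?_⟩
  have hn : n ≤ n ^ 4 := Nat.le_self_pow (by decide) n
  have hn2 : n * n ≤ n ^ 4 := sq n ▸ Nat.pow_le_pow_right hpos (by decide)
  have hn3 : n * n * n ≤ n ^ 4 := pow_three' n ▸ Nat.pow_le_pow_right hpos (by decide)
  simp only [Expr.cost] at ht₅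
  omega

end Main

end Program

end StableMarriage

theorem mainTheorem5 :
    -- correctness of the greedy algorithm, whatever the order of the removals
    (∀ (n : ℕ) (P : Profile n) (m : Fin n) (Y : Finset (Fin n)), GreedyReturns P m Y →
      IsMinimumNoRegretPushUpSet P m Y ∧ IsMinimumOptimal P m (pushUp P m Y)) ∧
    -- the program runs the greedy algorithm, in time `O(n ^ 4)`
    ∃ C : ℕ, ∀ (n : ℕ) (P : Profile n) (m : Fin n),
      ∃ (Y : Finset (Fin n)) (s : State Reg Tab) (t : ℕ),
        Exec Program.main (initState P m) s t ∧ t ≤ C * n ^ 4 ∧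
        Outputs s Y (pushUp P m Y) ∧ GreedyReturns P m Y ∧
        IsMinimumNoRegretPushUpSet P m Y ∧ IsMinimumOptimal P m (pushUp P m Y) := by
  have hcorrect (n : ℕ) (P : Profile n) (m : Fin n) (Y : Finset (Fin n))
      (hY : GreedyReturns P m Y) :
      IsMinimumNoRegretPushUpSet P m Y ∧ IsMinimumOptimal P m (pushUp P m Y) :=
    ⟨hY.isMinimumNoRegretPushUpSet, hY.isMinimumNoRegretPushUpSet.isMinimumOptimal⟩
  refine ⟨hcorrect, 5000, fun n P m => ?_⟩
  obtain ⟨s, t, hexec, Y, hout, hY, ht⟩ := Program.runs_main P m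
  exact ⟨Y, s, t, hexec, ht, hout, hY, hcorrect n P m Y hY⟩
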